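/- Everything is over $\mathbb{C}$. A sequence $c:\mathbb{N}\to\mathbb{N}\cup\{\infty\}$ is \emph{polynomially bounded} if $c_n\le q(n)$ for some polynomial $q$ and all $n$, and \emph{quasipolynomially bounded} if $c_n\le n^{q(\log_2 n)}$ for some polynomial $q$ and all $n\ge 2$. A \emph{p-family} is a sequence $(f_n)$ of polynomials whose number of variables and degree are polynomially bounded; $H$ is the set of p-families all of whose members are homogeneous. Write $g_{n,d}$ for the homogeneous degree $d$ part of $g_n$. For polynomials $f$ on $U$ and $g$ on $W$ ($U,W$ finite-dimensional complex vector spaces), $f\trianglelefteq g$ means $f\in\overline{\{g\circ A\mid A:U\to W\text{ linear}\}}$. A \emph{collection} assigns to each $(n,d)$ a homogeneous polynomial $F_{n,d}$ of degree $d$. For a class $K$ of p-families, the collection $F$ is \emph{$K$-$\overline{\mathrm{p}}$-hard} (hard for $K$ under homogeneous border p-projections) if for every $(g_n)\in K$ there is a polynomially bounded $q:\mathbb{N}\to\mathbb{N}$ with $g_{n,d}\trianglelefteq F_{q(n),d}$ for all $n$ and all $d>0$; it is \emph{$K$-$\overline{\mathrm{qp}}$-hard} (hard under homogeneous border qp-projections)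 if the same holds with $q$ quasipolynomially bounded. The \emph{parity-alternating elementary symmetric collection} is $$C_{n,d}=\sum x_{i_1}x_{i_2}\cdots x_{i_d}\in\mathbb{C}[x_1,\dots,x_n]_d,$$ where the sum is over all $1\le i_1<\dots<i_d\le n$ such that $i_1$ is odd and $i_j\not\equiv i_{j+1}\pmod 2$ for all $j$. \emph{Complexity classes.} $\mathsf{VQP}$ is the class of p-families with quasipolynomially bounded algebraic circuit size, and $\mathsf{VNP}$ is the class of p-families with polynomially bounded permanental complexity (the least $s$ such that the polynomial is the permanent of an $s\times s$ matrix of affine linear forms). Consider formulas whose leaves are labelled by homogeneous linear forms, whose additions have arity $2$ and whose products have arity exactly $3$; the size of a formula is its number of vertices. Such a formula computes a homogeneous polynomial of odd degree at its root; a homogeneous polynomial $f$ of even degree is computed by a multi-output formula (a forest) that computes all the partial derivatives $\partial f/\partial x_i$. $\mathsf{V3F}$ is the class of p-families in $H$ for which the minimal size of such a formula is polynomially bounded. The border version of a complexity measure assigns to $f$ the least $s$ such that $f$ is a limit of polynomials of complexity at most $s$. The classes $\overline{\mathsf{V3F}}$ and $\overline{\mathsf{VQP}}$ are obtained from $\mathsf{V3F}$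 and $\mathsf{VQP}$ by replacing the complexity measure by its border version. \textbf{Theorem.} \begin{enumerate} \item $C_{n,d}$ is $\mathsf{V3F}$-$\overline{\mathrm{p}}$-hard, and even $\overline{\mathsf{V3F}}$-$\overline{\mathrm{p}}$-hard. \item $C_{n,d}$ is $(\mathsf{VQP}\cap H)$-$\overline{\mathrm{qp}}$-hard, and even $(\overline{\mathsf{VQP}}\cap H)$-$\overline{\mathrm{qp}}$-hard. \item For a homogeneous polynomial $f$ let $\underline{c}(f)$ be the least $r$ such that $f$ is a polynomial in at most $r$ variables and, viewed as a polynomial in $r$ variables, lies in $\overline{\mathrm{GL}_r\, C_{r,\deg f}}$ ($\infty$ if there is no such $r$). Let $\mathrm{per}_m=\sum_{\sigma\in\mathfrak{S}_m}\prod_{i=1}^m x_{i,\sigma(i)}$. Then the extended Mulmuley--Sohoni conjecture $\mathsf{VNP}\not\subseteq\overline{\mathsf{VQP}}$ holds if and only if $\underline{c}(\mathrm{per}_m)$ grows superquasipolynomially in $m$, i.e. is not quasipolynomially bounded. \end{enumerate} -/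

import Mathlib

open scoped Topology

namespace AlgComplexity

/-! ## Growth of sequences -/

/-- `c` is polynomially bounded: `c n ≤ q(n)` for a polynomial `q` and all `n`. -/
def PolyBounded (c : ℕ → ℕ∞) : Prop :=
  ∃ q : Polynomial ℕ, ∀ n : ℕ, c n ≤ ((q.eval n : ℕ) : ℕ∞)

/-- `c` is quasipolynomially bounded: `c n ≤ n ^ q(log₂ n)` for a polynomial `q` and all
`n ≥ 2`. In particular `c n` is finite for all `n ≥ 2`. -/
def QuasiPolyBounded (c : ℕ → ℕ∞) : Prop :=
  ∃ q : Polynomial ℝ, ∀ n : ℕ, 2 ≤ n →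
    ∃ b : ℕ, c n = (b : ℕ∞) ∧ (b : ℝ) ≤ (n : ℝ) ^ (q.eval (Real.logb 2 (n : ℝ)))

/-- The least `s` with `P s`, and `⊤` if there is none. -/
noncomputable def least (P : ℕ → Prop) : ℕ∞ := ⨅ (s : ℕ) (_ : P s), (s : ℕ∞)

/-! ## p-families -/

/-- A p-family over `ℂ`: a sequence of polynomials whose number of variables and degree are
polynomially bounded. -/
structure PFamily where
  nvars : ℕ → ℕ
  poly : (n : ℕ) → MvPolynomial (Fin (nvars n)) ℂ
  nvars_bounded : PolyBounded fun n => (nvars n : ℕ∞)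
  degree_bounded : PolyBounded fun n => ((poly n).totalDegree : ℕ∞)

/-- The p-families all of whose members are homogeneous. -/
def Homogeneous : Set PFamily :=
  {f | ∀ n, ∃ d, (f.poly n).IsHomogeneous d}

/-! ## Approximation, orbits, degenerations -/

section Approximation

variable {σ τ : Type}

/-- Limits of sequences from `S` with respect to convergence of all coefficients. On each
finite-dimensional space of polynomials of bounded degree in finitely many variables this is
the Euclidean closure. -/
def limits (S : Set (MvPolynomial σ ℂ)) : Set (MvPolynomial σ ℂ) :=
  {f | ∃ h : ℕ → MvPolynomial σ ℂ, (∀ k, h k ∈ S) ∧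
    ∀ m : σ →₀ ℕ, Filter.Tendsto (fun k => (h k).coeff m) Filter.atTop (𝓝 (f.coeff m))}

/-- The border version of a complexity measure `μ`: the least `s` such that `f` can be
approximated arbitrarily closely by polynomials `h` with `μ h ≤ s`. -/
noncomputable def border (μ : MvPolynomial σ ℂ → ℕ∞) (f : MvPolynomial σ ℂ) : ℕ∞ :=
  least fun s => f ∈ limits {h | μ h ≤ (s : ℕ∞)}

/-- `g ∘ A` for the linear map `A` given by a matrix: `y_j ↦ ∑ i, A j i * x_i`. -/
noncomputable def compLinear [Fintype σ] (g : MvPolynomial τ ℂ) (A : Matrix τ σ ℂ) :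
    MvPolynomial σ ℂ :=
  MvPolynomial.aeval (fun j => ∑ i, MvPolynomial.C (A j i) * MvPolynomial.X i) g

/-- `f ⊴ g`: `f` is in the closure of `{g ∘ A | A linear}`. -/
def IsDegeneration [Fintype σ] (f : MvPolynomial σ ℂ) (g : MvPolynomial τ ℂ) : Prop :=
  f ∈ limits (Set.range fun A : Matrix τ σ ℂ => compLinear g A)

/-- The closure of the orbit `GL_r p`, where `(g p)(x) = p(gᵀ x)`. -/
def orbitClosure {r : ℕ} (p : MvPolynomial (Fin r) ℂ) : Set (MvPolynomial (Fin r) ℂ) :=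
  limits (Set.range fun g : Matrix.GeneralLinearGroup (Fin r) ℂ =>
    compLinear p (g : Matrix (Fin r) (Fin r) ℂ).transpose)

end Approximation

/-! ## Collections and hardness -/

/-- A collection: for all `n`, `d` a homogeneous polynomial of degree `d`. -/
structure Collection where
  nvars : ℕ → ℕ → ℕ
  poly : (n d : ℕ) → MvPolynomial (Fin (nvars n d)) ℂ
  homogeneous : ∀ n d, (poly n d).IsHomogeneous d

/-- Hardness of a collection for a class `K` of p-families under homogeneous border
p-projections. -/
def BorderPHard (F : Collection) (K : Set PFamily) : Prop :=
  ∀ g ∈ K, ∃ q : ℕ → ℕ, PolyBounded (fun n => (q n : ℕ∞)) ∧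
    ∀ d n : ℕ, 0 < d →
      IsDegeneration (MvPolynomial.homogeneousComponent d (g.poly n)) (F.poly (q n) d)

/-- Hardness of a collection for a class `K` of p-families under homogeneous border
qp-projections. -/
def BorderQPHard (F : Collection) (K : Set PFamily) : Prop :=
  ∀ g ∈ K, ∃ q : ℕ → ℕ, QuasiPolyBounded (fun n => (q n : ℕ∞)) ∧
    ∀ d n : ℕ, 0 < d →
      IsDegeneration (MvPolynomial.homogeneousComponent d (g.poly n)) (F.poly (q n) d)

/-! ## The parity-alternating elementary symmetric polynomials -/

/-- Increasing sequences `i₁ < ⋯ < i_d` in `{1, …, n}` with `i₁` odd and consecutive entries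
of different parity. The number `i` is represented by the element `i - 1` of `Fin n`. -/
def IsParityAlternating {n d : ℕ} (s : Fin d → Fin n) : Prop :=
  StrictMono s ∧
  (∀ j : Fin d, (j : ℕ) = 0 → Odd ((s j : ℕ) + 1)) ∧
  (∀ j k : Fin d, (k : ℕ) = (j : ℕ) + 1 → ((s j : ℕ) + 1) % 2 ≠ ((s k : ℕ) + 1) % 2)

open Classical in
/-- The polynomial `C_{n,d}`, in the variables `x₁, …, x_n`. -/
noncomputable def parityAltPoly (n d : ℕ) : MvPolynomial (Fin n) ℂ :=
  ∑ s : Fin d → Fin n with IsParityAlternating s, ∏ j, MvPolynomial.X (s j)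

theorem parityAltPoly_isHomogeneous (n d : ℕ) : (parityAltPoly n d).IsHomogeneous d := by
  classical
  unfold parityAltPoly
  refine MvPolynomial.IsHomogeneous.sum _ _ _ fun s _ => ?_
  simpa using MvPolynomial.IsHomogeneous.prod Finset.univ
    (fun j : Fin d => (MvPolynomial.X (s j) : MvPolynomial (Fin n) ℂ)) (fun _ => 1)
    (fun j _ => MvPolynomial.isHomogeneous_X ℂ (s j))

/-- The collection `C_{n,d}`. -/
noncomputable def parityAlt : Collection where
  nvars n _ := n
  poly := parityAltPoly
  homogeneous := parityAltPoly_isHomogeneous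

/-- `c(f)`: the least `r` such that `f`, seen as a polynomial in `r` variables, is in the
closure of the `GL_r`-orbit of `C_{r, deg f}`. -/
noncomputable def orbitClosureComplexity {v : ℕ} (f : MvPolynomial (Fin v) ℂ) : ℕ∞ :=
  least fun r => ∃ h : v ≤ r,
    MvPolynomial.rename (Fin.castLE h) f ∈ orbitClosure (parityAltPoly r f.totalDegree)

/-! ## Input-homogeneous-linear formulas over the arity 3 basis -/

/-- Formulas with leaves labelled by homogeneous linear forms (given by their coefficients),
additions of arity 2 and products of arity 3. -/
inductive Formula3 (σ : Type) : Type
  | leaf (a : σ → ℂ) : Formula3 σ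
  | add (φ ψ : Formula3 σ) : Formula3 σ
  | mul (φ ψ χ : Formula3 σ) : Formula3 σ

/-- The number of vertices of a formula. -/
def Formula3.size {σ : Type} : Formula3 σ → ℕ
  | .leaf _ => 1
  | .add φ ψ => φ.size + ψ.size + 1
  | .mul φ ψ χ => φ.size + ψ.size + χ.size + 1

/-- The polynomial computed by a formula. -/
noncomputable def Formula3.eval {σ : Type} [Fintype σ] : Formula3 σ → MvPolynomial σ ℂ
  | .leaf a => ∑ i, MvPolynomial.C (a i) * MvPolynomial.X i
  | .add φ ψ => φ.eval + ψ.eval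
  | .mul φ ψ χ => φ.eval * ψ.eval * χ.eval

/-- The formula complexity over the arity 3 basis of a homogeneous polynomial. A polynomial of
odd degree is computed at the root of a formula; a polynomial of even degree is computed by a
multi-output formula (one tree for each output) whose outputs are all its partial
derivatives. -/
noncomputable def formula3Size {σ : Type} [Fintype σ] (f : MvPolynomial σ ℂ) : ℕ∞ :=
  least fun s =>
    (∃ d, Odd d ∧ f.IsHomogeneous d ∧ ∃ φ : Formula3 σ, φ.eval = f ∧ φ.size = s) ∨
    (∃ d, Even d ∧ f.IsHomogeneous d ∧ ∃ φ : σ → Formula3 σ,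
      (∀ i, (φ i).eval = MvPolynomial.pderiv i f) ∧ ∑ i, (φ i).size = s)

/-- The class `V3F`. -/
def V3F : Set PFamily :=
  {f | f ∈ Homogeneous ∧ PolyBounded fun n => formula3Size (f.poly n)}

/-- The closure of `V3F`. -/
def V3FClosure : Set PFamily :=
  {f | f ∈ Homogeneous ∧ PolyBounded fun n => border formula3Size (f.poly n)}

/-! ## Algebraic circuits -/

/-- A gate at position `i` of a circuit: an input labelled by a variable or by a constant, or an
arithmetic gate whose two children are at earlier positions. -/
inductive Gate (σ : Type) (i : ℕ) : Type
  | var (x : σ) : Gate σ i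
  | const (a : ℂ) : Gate σ i
  | add (j k : Fin i) : Gate σ i
  | mul (j k : Fin i) : Gate σ i

/-- An algebraic circuit: a directed acyclic graph of gates in topological order. -/
structure Circuit (σ : Type) where
  size : ℕ
  gate : (i : Fin size) → Gate σ i
  output : Fin size

/-- The polynomial computed at a gate. -/
noncomputable def Circuit.value {σ : Type} (Γ : Circuit σ) (i : Fin Γ.size) :
    MvPolynomial σ ℂ :=
  match Γ.gate i with
  | .var x => MvPolynomial.X x
  | .const a => MvPolynomial.C a
  | .add j k => Γ.value ⟨j, j.2.trans i.2⟩ + Γ.value ⟨k, k.2.trans i.2⟩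
  | .mul j k => Γ.value ⟨j, j.2.trans i.2⟩ * Γ.value ⟨k, k.2.trans i.2⟩
termination_by i.val
decreasing_by
  all_goals first | exact j.2 | exact k.2

/-- The algebraic circuit complexity. -/
noncomputable def circuitSize {σ : Type} (f : MvPolynomial σ ℂ) : ℕ∞ :=
  least fun s => ∃ Γ : Circuit σ, Γ.value Γ.output = f ∧ Γ.size = s

/-- The class `VQP`. -/
def VQP : Set PFamily :=
  {f | QuasiPolyBounded fun n => circuitSize (f.poly n)}

/-- The closure of `VQP`. -/
def VQPClosure : Set PFamily :=
  {f | QuasiPolyBounded fun n => border circuitSize (f.poly n)}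

/-! ## Permanents and the extended Mulmuley-Sohoni conjecture -/

/-- The permanent polynomial `per_m` in `m * m` variables. -/
noncomputable def per (m : ℕ) : MvPolynomial (Fin (m * m)) ℂ :=
  Matrix.permanent (Matrix.of fun i j : Fin m => MvPolynomial.X (finProdFinEquiv (i, j)))

/-- The permanental complexity: the least `s` such that `f` is the permanent of an `s × s`
matrix of affine linear forms. -/
noncomputable def permanentalComplexity {σ : Type} (f : MvPolynomial σ ℂ) : ℕ∞ :=
  least fun s => ∃ M : Matrix (Fin s) (Fin s) (MvPolynomial σ ℂ),
    (∀ i j, (M i j).totalDegree ≤ 1) ∧ M.permanent = f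

/-- The class `VNP`. -/
def VNP : Set PFamily :=
  {f | PolyBounded fun n => permanentalComplexity (f.poly n)}

/-- The extended Mulmuley-Sohoni conjecture: `VNP` is not contained in the closure
of `VQP`. -/
def ExtendedMulmuleySohoni : Prop := ¬ VNP ⊆ VQPClosure

end AlgComplexity

/-! Why the theorem holds. Multiply the elementary matrices U(y₁) L(y₂) U(y₃) ⋯, alternately upper
and lower triangular, with linear forms as entries. The degree `d` part of the first row is
`C_{N,d}` evaluated at the forms: in the diagonal entry for even `d`, in the other entry for odd `d`
(`homogeneousComponent_altWord`). Hardness therefore means producing polynomials, in the limit, as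
entries of short words in elementary matrices. Everything takes place in the power series ring with
coefficientwise convergence, where closures, products and homogeneous components behave well.

Say that `p` is reached when U(p) is a limit of words of a given length. Sums come from
concatenation and scalars from conjugation. As t → 0, U(a/t) L(t²g) U(-a/t) tends to U(-a²g), and
polarization turns this into the ternary product `a * b * g` (`Reaches.mul3`). Reached series have
only odd degree parts, which is why products have arity 3. Balancing a formula keeps the word length
polynomial (`Formula3.reaches_pow`). For even degree, Euler's formula writes `f` as a sum of
products of two reached series; such a sum is the derivative at t = 0 of ∏ (1 + t a b), and each
factor can be appended to a first row (u, 0) in the limit (`homogeneousComponent_sum_mem`).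

For circuits, a series is split into a reached part, a constant and a short sum of products of two
reached series. Such splittings can be multiplied, at a cost exponential in the square of the
multiplicative depth, so a depth polylogarithmic in size and degree is needed. Newton iteration for
the gate equations provides it: each step doubles the order of the error, and the nilpotent Jacobian
is inverted by repeated squaring (`Circuit.exists_isSplitLevel`).

For the conjecture, the permanent itself is a VNP family, and a degeneration of `C` becomes a point
of an orbit closure after adding variables, because invertible matrices are dense. Conversely `C`
has small circuits by its recursion, so a small orbit closure complexity of the permanent bounds the
border circuit size of every VNP family by substitution. -/

namespace AlgComplexity

open scoped MvPowerSeries.WithPiTopology Pointwise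

/-! ## Normal forms of the growth conditions -/

theorem exists_eval_le_pow (q : Polynomial ℕ) : ∃ k : ℕ, ∀ n : ℕ, q.eval n ≤ (n + 2) ^ k := by
  induction q using Polynomial.induction_on' with
  | add p q hp hq =>
    obtain ⟨k, hk⟩ := hp
    obtain ⟨l, hl⟩ := hq
    refine ⟨k + l + 1, fun n => ?_⟩
    have h1 : (n + 2) ^ k ≤ (n + 2) ^ (k + l) := Nat.pow_le_pow_right (by omega) (by omega)
    have h2 : (n + 2) ^ l ≤ (n + 2) ^ (k + l) := Nat.pow_le_pow_right (by omega) (by omega)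
    rw [Polynomial.eval_add, pow_succ]
    nlinarith [hk n, hl n, Nat.zero_le ((n + 2) ^ (k + l) * n)]
  | monomial i a =>
    refine ⟨a + i, fun n => ?_⟩
    rw [Polynomial.eval_monomial, pow_add]
    refine Nat.mul_le_mul ?_ (Nat.pow_le_pow_left (by omega) i)
    calc a ≤ 2 ^ a := Nat.lt_two_pow_self.le
      _ ≤ (n + 2) ^ a := Nat.pow_le_pow_left (by omega) a

theorem polyBounded_iff {c : ℕ → ℕ∞} :
    PolyBounded c ↔ ∃ k : ℕ, ∀ n : ℕ, c n ≤ (((n + 2) ^ k : ℕ) : ℕ∞) := by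
  constructor
  · rintro ⟨q, hq⟩
    obtain ⟨k, hk⟩ := exists_eval_le_pow q
    exact ⟨k, fun n => (hq n).trans (by exact_mod_cast hk n)⟩
  · rintro ⟨k, hk⟩
    exact ⟨(Polynomial.X + 2) ^ k, fun n => (hk n).trans (by simp)⟩

theorem exists_real_eval_le_pow (q : Polynomial ℝ) :
    ∃ k : ℕ, ∀ x : ℝ, 0 ≤ x → q.eval x ≤ (x + 2) ^ k := by
  induction q using Polynomial.induction_on' with
  | add p q hp hq =>
    obtain ⟨k, hk⟩ := hp
    obtain ⟨l, hl⟩ := hq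
    refine ⟨k + l + 1, fun x hx => ?_⟩
    have h1 : (x + 2) ^ k ≤ (x + 2) ^ (k + l) := pow_le_pow_right₀ (by linarith) (by omega)
    have h2 : (x + 2) ^ l ≤ (x + 2) ^ (k + l) := pow_le_pow_right₀ (by linarith) (by omega)
    have h3 : 0 ≤ (x + 2) ^ (k + l) * x := by positivity
    rw [Polynomial.eval_add, pow_succ]
    nlinarith [hk x hx, hl x hx]
  | monomial i a =>
    obtain ⟨m, hm⟩ := exists_nat_ge a
    refine ⟨m + i, fun x hx => ?_⟩
    rw [Polynomial.eval_monomial, pow_add]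
    refine mul_le_mul ?_ (pow_le_pow_left₀ hx (by linarith) i) (by positivity) (by positivity)
    calc a ≤ m := hm
      _ ≤ 2 ^ m := by exact_mod_cast Nat.lt_two_pow_self.le
      _ ≤ (x + 2) ^ m := pow_le_pow_left₀ (by norm_num) (by linarith) m

theorem quasiPolyBounded_iff {c : ℕ → ℕ∞} :
    QuasiPolyBounded c ↔
      ∃ k : ℕ, ∀ n : ℕ, 2 ≤ n → c n ≤ ((2 ^ (Nat.log 2 n + 2) ^ k : ℕ) : ℕ∞) := by
  constructor
  · rintro ⟨q, hq⟩
    obtain ⟨k, hk⟩ := exists_real_eval_le_pow q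
    -- With n = 2^x the bound is 2^(x q(x)). Rounding gives x + 2 ≤ l + 3 ≤ (l + 2)², hence 2k, and
    -- the factor x adds 1.
    refine ⟨2 * k + 1, fun n hn => ?_⟩
    obtain ⟨b, hb, hle⟩ := hq n hn
    rw [hb]
    have hn0 : (0 : ℝ) < n := by positivity
    have hx0 : 0 ≤ Real.logb 2 n :=
      Real.logb_nonneg (by norm_num) (by exact_mod_cast (by omega : 1 ≤ n))
    have hx1 : Real.logb 2 n ≤ Nat.log 2 n + 1 := by
      rw [Real.logb_le_iff_le_rpow (by norm_num) hn0]
      have := (Nat.lt_pow_succ_log_self (b := 2) (by norm_num) n).le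
      have h2 : (n : ℝ) ≤ 2 ^ (Nat.log 2 n + 1) := by exact_mod_cast this
      exact_mod_cast h2
    set x := Real.logb 2 n
    set l := Nat.log 2 n
    have hl1 : 1 ≤ l := Nat.log_pos (by norm_num) hn
    have hl : ((l : ℝ) + 3) ≤ (l + 2) ^ 2 := by nlinarith [(Nat.cast_nonneg l : (0:ℝ) ≤ l)]
    have hexp : x * q.eval x ≤ ((l : ℝ) + 2) ^ (2 * k + 1) := by
      have h1 : q.eval x ≤ ((l : ℝ) + 2) ^ (2 * k) := by
        refine (hk x hx0).trans ?_
        rw [pow_mul]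
        exact pow_le_pow_left₀ (by linarith) (by linarith) k
      calc x * q.eval x ≤ x * ((l : ℝ) + 2) ^ (2 * k) := mul_le_mul_of_nonneg_left h1 hx0
        _ ≤ ((l : ℝ) + 2) * ((l : ℝ) + 2) ^ (2 * k) :=
          mul_le_mul_of_nonneg_right (by linarith) (by positivity)
        _ = _ := by ring
    have hfin : (b : ℝ) ≤ (2 : ℝ) ^ ((((l + 2) ^ (2 * k + 1) : ℕ)) : ℝ) := by
      refine hle.trans ?_
      calc (n : ℝ) ^ (q.eval x) = ((2 : ℝ) ^ x) ^ (q.eval x) := by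
            rw [Real.rpow_logb (by norm_num) (by norm_num) hn0]
        _ = (2 : ℝ) ^ (x * q.eval x) := by rw [← Real.rpow_mul (by norm_num)]
        _ ≤ _ := Real.rpow_le_rpow_of_exponent_le (by norm_num) (by push_cast; exact hexp)
    rw [Real.rpow_natCast] at hfin
    exact_mod_cast hfin
  · rintro ⟨k, hk⟩
    refine ⟨(Polynomial.X + 2) ^ k, fun n hn => ?_⟩
    obtain ⟨b, hb⟩ := ENat.ne_top_iff_exists.mp (ne_top_of_le_ne_top (ENat.natCast_ne_top _) (hk n hn))
    refine ⟨b, hb.symm, ?_⟩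
    have hb2 := hk n hn
    rw [← hb] at hb2
    have hb3 : b ≤ 2 ^ (Nat.log 2 n + 2) ^ k := by exact_mod_cast hb2
    have hn0 : (0 : ℝ) < n := by positivity
    have hlog : (Nat.log 2 n : ℝ) ≤ Real.logb 2 n := by
      rw [Real.le_logb_iff_rpow_le (by norm_num) hn0, Real.rpow_natCast]
      exact_mod_cast Nat.pow_log_le_self 2 (by omega)
    have h2n : (2 : ℝ) ≤ n := by exact_mod_cast hn
    calc (b : ℝ) ≤ (2 : ℝ) ^ ((Nat.log 2 n + 2) ^ k) := by exact_mod_cast hb3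
      _ = (2 : ℝ) ^ (((Nat.log 2 n : ℝ) + 2) ^ k) := by
        rw [← Real.rpow_natCast]; push_cast; rfl
      _ ≤ (2 : ℝ) ^ ((Real.logb 2 n + 2) ^ k) :=
        Real.rpow_le_rpow_of_exponent_le (by norm_num)
          (pow_le_pow_left₀ (by positivity) (by linarith) k)
      _ ≤ (n : ℝ) ^ ((Real.logb 2 n + 2) ^ k) :=
        Real.rpow_le_rpow (by norm_num) h2n
          (pow_nonneg (by linarith [(Nat.cast_nonneg (Nat.log 2 n) : (0:ℝ) ≤ Nat.log 2 n)]) k)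
      _ = _ := by simp

theorem least_le_iff {P : ℕ → Prop} {s : ℕ} : least P ≤ (s : ℕ∞) ↔ ∃ t ≤ s, P t := by
  classical
  constructor
  · intro h
    by_contra! hcon
    have : ((s + 1 : ℕ) : ℕ∞) ≤ least P := by
      refine le_iInf₂ fun t ht => ?_
      have : ¬ t ≤ s := fun hts => hcon t hts ht
      exact_mod_cast (by omega : s + 1 ≤ t)
    have h2 := this.trans h
    have h3 : s + 1 ≤ s := by exact_mod_cast h2
    omega
  · rintro ⟨t, hts, ht⟩
    exact (iInf₂_le t ht).trans (by exact_mod_cast hts)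

/-! ## Words of elementary matrices and their limits -/


section Words

variable {σ : Type}

/-- Power series in the variables `σ`, with the topology of coefficientwise convergence. -/
abbrev Ser (σ : Type) : Type := MvPowerSeries σ ℂ

/-- The `2 × 2` matrices over the ring of power series. -/
abbrev Mat (σ : Type) : Type := Matrix (Fin 2) (Fin 2) (Ser σ)

/-- The upper triangular elementary matrix. -/
noncomputable def upper (a : Ser σ) : Mat σ := !![1, a; 0, 1]

/-- The lower triangular elementary matrix. -/
noncomputable def lower (a : Ser σ) : Mat σ := !![1, 0; a, 1]

/-- The linear form with coefficients `a`. -/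
noncomputable def linForm [Fintype σ] (a : σ → ℂ) : Ser σ :=
  ∑ i, MvPowerSeries.C (a i) * MvPowerSeries.X i

/-- The elementary matrices with a linear form as off-diagonal entry. -/
def letters (σ : Type) [Fintype σ] : Set (Mat σ) :=
  {m | ∃ a : σ → ℂ, m = upper (linForm a) ∨ m = lower (linForm a)}

/-- The limits of products of `L` elementary matrices with linear entries. -/
def wordLimits (σ : Type) [Fintype σ] (L : ℕ) : Set (Mat σ) := closure (letters σ ^ L)

/-- `upper p` is a limit of products of `L` elementary matrices with linear entries. -/
def Reaches [Fintype σ] (L : ℕ) (p : Ser σ) : Prop := upper p ∈ wordLimits σ L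

theorem upper_mul_upper (a b : Ser σ) : upper a * upper b = upper (a + b) := by
  ext i j : 1; fin_cases i <;> fin_cases j <;> simp [upper, Matrix.mul_apply, Fin.sum_univ_two, add_comm]

theorem upper_zero : upper (0 : Ser σ) = 1 := by
  ext i j : 1; fin_cases i <;> fin_cases j <;> simp [upper]

theorem lower_zero : lower (0 : Ser σ) = 1 := by
  ext i j : 1; fin_cases i <;> fin_cases j <;> simp [lower]

theorem C_mul_C_inv {t : ℂ} (ht : t ≠ 0) :
    (MvPowerSeries.C t * MvPowerSeries.C t⁻¹ : Ser σ) = 1 := by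
  rw [← map_mul, mul_inv_cancel₀ ht, map_one]

theorem continuous_C_ofReal : Continuous fun t : ℝ => (MvPowerSeries.C (t : ℂ) : Ser σ) :=
  MvPowerSeries.WithPiTopology.continuous_C.comp Complex.continuous_ofReal

variable [Fintype σ]

theorem linForm_zero : linForm (0 : σ → ℂ) = 0 := by simp [linForm]

theorem C_mul_linForm (t : ℂ) (a : σ → ℂ) :
    MvPowerSeries.C t * linForm a = linForm (t • a) := by
  simp [linForm, Finset.mul_sum, mul_assoc]

theorem one_mem_letters : (1 : Mat σ) ∈ letters σ :=
  ⟨0, Or.inl (by rw [linForm_zero, upper_zero])⟩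

theorem wordLimits_mono {L M : ℕ} (h : L ≤ M) : wordLimits σ L ⊆ wordLimits σ M :=
  closure_mono (Set.pow_subset_pow_right one_mem_letters h)

theorem mul_mem_wordLimits {L M : ℕ} {X Y : Mat σ} (hX : X ∈ wordLimits σ L)
    (hY : Y ∈ wordLimits σ M) : X * Y ∈ wordLimits σ (L + M) := by
  rw [wordLimits, pow_add]
  exact map_mem_closure₂ continuous_mul hX hY fun a ha b hb => Set.mul_mem_mul ha hb

/-- Conjugation is continuous and multiplicative, so if it maps letters to letters it maps words to
words of the same length. -/
theorem conj_mem_wordLimits {P Q : Mat σ} (hQP : Q * P = 1) (hPQ : P * Q = 1)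
    (hl : ∀ m ∈ letters σ, P * m * Q ∈ letters σ) {L : ℕ} {X : Mat σ} (hX : X ∈ wordLimits σ L) :
    P * X * Q ∈ wordLimits σ L := by
  refine map_mem_closure (f := fun m : Mat σ => P * m * Q) ((continuous_const.mul continuous_id).mul continuous_const) hX ?_
  clear hX
  induction L with
  | zero =>
    intro m hm
    rw [pow_zero, Set.mem_one] at hm ⊢
    rw [hm]
    show P * 1 * Q = 1
    rw [mul_one, hPQ]
  | succ L ih =>
    intro m hm
    rw [pow_succ] at hm ⊢
    obtain ⟨a, ha, b, hb, rfl⟩ := hm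
    have : P * (a * b) * Q = (P * a * Q) * (P * b * Q) := by
      calc P * (a * b) * Q = P * a * 1 * b * Q := by noncomm_ring
        _ = P * a * (Q * P) * b * Q := by rw [hQP]
        _ = _ := by noncomm_ring
    show P * (a * b) * Q ∈ _
    rw [this]
    refine Set.mul_mem_mul (ih ha) (hl b hb)

/-- Conjugation by diag(t, 1) multiplies the upper entry by t and the lower one by t⁻¹, so it
preserves the letters. For t = 0 the empty word serves. -/
theorem reaches_smul {L : ℕ} {p : Ser σ} (t : ℂ) (hp : Reaches L p) :
    Reaches L (MvPowerSeries.C t * p) := by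
  rcases eq_or_ne t 0 with rfl | ht
  · have h1 : (1 : Mat σ) ∈ wordLimits σ 0 := subset_closure (by simp)
    have := wordLimits_mono (Nat.zero_le L) h1
    simpa [Reaches, upper_zero] using this
  · have e1 := C_mul_C_inv (σ := σ) ht
    have e2 : (MvPowerSeries.C t⁻¹ * MvPowerSeries.C t : Ser σ) = 1 := by rw [mul_comm, e1]
    have key : ∀ x : Ser σ, !![MvPowerSeries.C t, 0; 0, 1] * upper x *
        !![MvPowerSeries.C t⁻¹, 0; 0, 1] = upper (MvPowerSeries.C t * x) := fun x => by
      ext i j : 1; fin_cases i <;> fin_cases j <;> simp [upper, Matrix.mul_apply, Fin.sum_univ_two, e1]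
    have key2 : ∀ x : Ser σ, !![MvPowerSeries.C t, 0; 0, 1] * lower x *
        !![MvPowerSeries.C t⁻¹, 0; 0, 1] = lower (MvPowerSeries.C t⁻¹ * x) := fun x => by
      ext i j : 1
      fin_cases i <;> fin_cases j <;>
        simp [lower, Matrix.mul_apply, Fin.sum_univ_two, e1, mul_comm]
    have := conj_mem_wordLimits (P := !![MvPowerSeries.C t, 0; 0, 1])
      (Q := !![MvPowerSeries.C t⁻¹, 0; 0, 1]) ?_ ?_ ?_ hp
    · rwa [key] at this
    · ext i j : 1; fin_cases i <;> fin_cases j <;> simp [Matrix.mul_apply, Fin.sum_univ_two, e2]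
    · ext i j : 1; fin_cases i <;> fin_cases j <;> simp [Matrix.mul_apply, Fin.sum_univ_two, e1]
    · rintro m ⟨a, rfl | rfl⟩
      · exact ⟨t • a, Or.inl (by rw [key, C_mul_linForm])⟩
      · exact ⟨t⁻¹ • a, Or.inr (by rw [key2, C_mul_linForm])⟩

theorem lower_mem_wordLimits {L : ℕ} {p : Ser σ} (hp : Reaches L p) :
    lower p ∈ wordLimits σ L := by
  have key : ∀ x : Ser σ, !![0, 1; 1, 0] * upper x * !![0, 1; 1, 0] = lower x := fun x => by
    ext i j : 1; fin_cases i <;> fin_cases j <;>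
      simp [upper, lower, Matrix.mul_apply, Fin.sum_univ_two]
  have key2 : ∀ x : Ser σ, !![0, 1; 1, 0] * lower x * !![0, 1; 1, 0] = upper x := fun x => by
    ext i j : 1; fin_cases i <;> fin_cases j <;>
      simp [upper, lower, Matrix.mul_apply, Fin.sum_univ_two]
  have h1 : (!![0, 1; 1, 0] * !![0, 1; 1, 0] : Mat σ) = 1 := by
    ext i j : 1; fin_cases i <;> fin_cases j <;> simp [Matrix.mul_apply, Fin.sum_univ_two]
  rw [← key]
  refine conj_mem_wordLimits h1 h1 ?_ hp
  rintro m ⟨a, rfl | rfl⟩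
  · exact ⟨a, Or.inr (key _)⟩
  · exact ⟨a, Or.inl (key2 _)⟩

theorem reaches_zero (L : ℕ) : Reaches L (0 : Ser σ) := by
  have h1 : (1 : Mat σ) ∈ wordLimits σ 0 := subset_closure (by simp)
  simpa [Reaches, upper_zero] using wordLimits_mono (Nat.zero_le L) h1

theorem Reaches.mono {L M : ℕ} (h : L ≤ M) {p : Ser σ} (hp : Reaches L p) : Reaches M p :=
  wordLimits_mono h hp

theorem reaches_linForm (a : σ → ℂ) : Reaches 1 (linForm a) :=
  subset_closure (by rw [pow_one]; exact ⟨a, Or.inl rfl⟩)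

theorem reaches_X (i : σ) : Reaches 1 (MvPowerSeries.X i : Ser σ) := by
  classical
  have h1 : (MvPowerSeries.X i : Ser σ) = linForm (Pi.single i 1) := by
    rw [linForm, Finset.sum_eq_single i]
    · simp
    · intro j _ hj
      simp [Pi.single_eq_of_ne hj]
    · simp
  rw [h1]
  exact reaches_linForm _

theorem Reaches.add {L M : ℕ} {p q : Ser σ} (hp : Reaches L p) (hq : Reaches M q) :
    Reaches (L + M) (p + q) := by
  rw [Reaches, ← upper_mul_upper]
  exact mul_mem_wordLimits hp hq

theorem Reaches.neg {L : ℕ} {p : Ser σ} (hp : Reaches L p) : Reaches L (-p) := by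
  simpa using reaches_smul (-1) hp

theorem Reaches.sub {L M : ℕ} {p q : Ser σ} (hp : Reaches L p) (hq : Reaches M q) :
    Reaches (L + M) (p - q) := by
  rw [sub_eq_add_neg]
  exact hp.add hq.neg

/-- The word U(a/t) L(t²g) U(-a/t) has entries polynomial in t although its factors diverge; `W` is
the product multiplied out, and its value at t = 0 is the desired matrix. -/
theorem Reaches.neg_sq_mul {L M : ℕ} {a g : Ser σ} (ha : Reaches L a) (hg : Reaches M g) :
    Reaches (2 * L + M) (-(a ^ 2 * g)) := by
  let c : ℝ → Ser σ := fun t => MvPowerSeries.C (t : ℂ)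
  have hc : Continuous c := continuous_C_ofReal
  let W : ℝ → Mat σ := fun t => !![1 + c t * (a * g), -(a ^ 2 * g); c t ^ 2 * g, 1 - c t * (a * g)]
  have hW : Continuous W := by
    refine continuous_matrix fun i j => ?_
    fin_cases i <;> fin_cases j <;> simp [W] <;> fun_prop
  have h0 : W 0 = upper (-(a ^ 2 * g)) := by
    ext i j : 1; fin_cases i <;> fin_cases j <;> simp [W, upper, c]
  have hmem : ∀ t : ℝ, 0 < t → W t ∈ wordLimits σ (2 * L + M) := by
    intro t ht
    have ht' : (t : ℂ) ≠ 0 := by exact_mod_cast ht.ne'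
    have e : c t * MvPowerSeries.C (t : ℂ)⁻¹ = 1 := C_mul_C_inv ht'
    set u : Ser σ := MvPowerSeries.C (t : ℂ)⁻¹
    have e1 : W t = upper (u * a) * lower (c t ^ 2 * g) * upper (-(u * a)) := by
      ext i j : 1
      fin_cases i <;> fin_cases j <;>
        simp [W, upper, lower, Matrix.mul_apply, Fin.sum_univ_two]
      · linear_combination (-(a * g * c t)) * e
      · linear_combination (a ^ 2 * g) * (1 + c t * u) * e
      · linear_combination (a * g * c t) * e
    have hs : Reaches M (c t ^ 2 * g) := by
      have := reaches_smul ((t : ℂ) ^ 2) hg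
      rwa [map_pow] at this
    have := mul_mem_wordLimits (mul_mem_wordLimits (reaches_smul (t : ℂ)⁻¹ ha)
      (lower_mem_wordLimits hs)) (reaches_smul (t : ℂ)⁻¹ ha).neg
    rw [e1, two_mul, add_assoc, add_comm L M, ← add_assoc]
    exact this
  rw [Reaches, ← h0]
  refine isClosed_closure.mem_of_tendsto (b := 𝓝[>] (0:ℝ)) (f := W)
    ((hW.tendsto 0).mono_left nhdsWithin_le_nhds) ?_
  filter_upwards [self_mem_nhdsWithin] with t ht using hmem t ht

/-- Polarization: 4ab = (a + b)² - (a - b)². Each of the two squares costs 2(L + M) + K. -/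
theorem Reaches.mul3 {L M K : ℕ} {a b g : Ser σ} (ha : Reaches L a) (hb : Reaches M b)
    (hg : Reaches K g) : Reaches (4 * L + 4 * M + 2 * K) (a * b * g) := by
  have h1 := reaches_smul (1 / 4) ((ha.sub hb).neg_sq_mul hg)
  have h2 := reaches_smul (-1 / 4) ((ha.add hb).neg_sq_mul hg)
  have h := (h1.add h2).mono (show _ ≤ 4 * L + 4 * M + 2 * K by omega)
  have e4 : (MvPowerSeries.C (1 / 4 : ℂ) * 4 : Ser σ) = 1 := by
    have : (4 : Ser σ) = MvPowerSeries.C (4 : ℂ) := (map_ofNat _ 4).symm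
    rw [this, ← map_mul]; norm_num
  have e5 : (MvPowerSeries.C (-1 / 4 : ℂ) : Ser σ) = - MvPowerSeries.C (1 / 4 : ℂ) := by
    rw [← map_neg]; congr 1; norm_num
  convert h using 1
  rw [e5]
  linear_combination (-(a * b * g)) * e4

end Words

/-! ## The recursion for the parity-alternating polynomials -/

section Alternating

/-- The value of `C_{N,d}` at the first `N` members of `y`, by recursion on `N`. -/
def alt {A : Type*} [CommRing A] (y : ℕ → A) : ℕ → ℕ → A
  | _, 0 => 1
  | 0, _ + 1 => 0
  | N + 1, d + 1 => alt y N (d + 1) + if N % 2 = d % 2 then y N * alt y N d else 0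

/-- Counted from 0, an alternating sequence starts with an even index, so the parity of every entry
is that of its position. -/
theorem isParityAlternating_iff {n d : ℕ} (s : Fin d → Fin n) :
    IsParityAlternating s ↔ StrictMono s ∧ ∀ j, (s j : ℕ) % 2 = (j : ℕ) % 2 := by
  constructor
  · rintro ⟨h1, h2, h3⟩
    refine ⟨h1, ?_⟩
    rintro ⟨j, hj⟩
    induction j with
    | zero =>
      have := h2 ⟨0, hj⟩ rfl
      rw [Nat.odd_iff] at this
      simp only
      omega
    | succ j ih =>
      have := ih (by omega)
      have := h3 ⟨j, by omega⟩ ⟨j + 1, hj⟩ rfl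
      simp only at *
      omega
  · rintro ⟨h1, h2⟩
    refine ⟨h1, fun j hj => ?_, fun j k hjk => ?_⟩
    · rw [Nat.odd_iff]
      have := h2 j
      omega
    · have := h2 j
      have := h2 k
      omega

theorem parityAltPoly_zero_right (n : ℕ) : parityAltPoly n 0 = 1 := by
  classical
  unfold parityAltPoly
  rw [Finset.filter_true_of_mem]
  · simp
  · intro s _
    rw [isParityAlternating_iff]
    exact ⟨fun i => i.elim0, fun i => i.elim0⟩

theorem parityAltPoly_zero_left (d : ℕ) : parityAltPoly 0 (d + 1) = 0 := by
  classical
  unfold parityAltPoly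
  exact Finset.sum_eq_zero fun s _ => (s 0).elim0

/-- The monomials are sorted by whether their last variable is the one of index N. It would stand at
position d, which the parity condition allows only if N and d agree mod 2. -/
theorem parityAltPoly_succ (N d : ℕ) :
    parityAltPoly (N + 1) (d + 1) =
      MvPolynomial.rename Fin.castSucc (parityAltPoly N (d + 1)) +
      if N % 2 = d % 2 then
        MvPolynomial.X (Fin.last N) * MvPolynomial.rename Fin.castSucc (parityAltPoly N d)
      else 0 := by
  classical
  have hsplit := Finset.sum_filter_add_sum_filter_not
    (Finset.univ.filter fun s : Fin (d + 1) → Fin (N + 1) => IsParityAlternating s)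
    (fun s => s (Fin.last d) = Fin.last N)
    (fun s => ∏ j, (MvPolynomial.X (s j) : MvPolynomial (Fin (N + 1)) ℂ))
  conv_lhs => unfold parityAltPoly
  refine (hsplit.symm.trans (add_comm _ _)).trans ?_
  congr 1
  · simp only [parityAltPoly, map_sum, map_prod, MvPolynomial.rename_X]
    symm
    refine Finset.sum_bij (fun s _ j => (s j).castSucc) ?_ ?_ ?_ ?_
    · intro s hs
      simp only [Finset.mem_filter, Finset.mem_univ, true_and, isParityAlternating_iff] at hs ⊢
      refine ⟨⟨fun a b hab => ?_, fun j => by simpa using hs.2 j⟩, ?_⟩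
      · simpa using hs.1 hab
      · exact (Fin.castSucc_lt_last _).ne
    · intro s _ t _ h
      funext j
      exact Fin.castSucc_injective _ (congrFun h j)
    · intro s hs
      simp only [Finset.mem_filter, Finset.mem_univ, true_and, isParityAlternating_iff] at hs
      have hlt : ∀ j, (s j : ℕ) < N := fun j => by
        have h1 : s j ≤ s (Fin.last d) := hs.1.1.monotone (Fin.le_last j)
        have h2 : s (Fin.last d) < Fin.last N := lt_of_le_of_ne (Fin.le_last _) hs.2
        exact lt_of_le_of_lt h1 h2
      refine ⟨fun j => ⟨s j, hlt j⟩, ?_, rfl⟩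
      simp only [Finset.mem_filter, Finset.mem_univ, true_and, isParityAlternating_iff]
      exact ⟨fun a b hab => hs.1.1 hab, hs.1.2⟩
    · intro s _
      rfl
  · split_ifs with hpar
    · simp only [parityAltPoly, map_sum, map_prod, MvPolynomial.rename_X, Finset.mul_sum]
      symm
      refine Finset.sum_bij
        (fun s _ => Fin.snoc (α := fun _ => Fin (N + 1)) (fun j => (s j).castSucc) (Fin.last N))
        ?_ ?_ ?_ ?_
      · intro s hs
        simp only [Finset.mem_filter, Finset.mem_univ, true_and, isParityAlternating_iff] at hs ⊢
        refine ⟨⟨fun a b => ?_, fun j => ?_⟩, by simp⟩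
        · refine Fin.lastCases ?_ (fun a => ?_) a <;> refine Fin.lastCases ?_ (fun b => ?_) b
          · simp
          · intro h
            exact absurd h (not_lt.mpr (Fin.le_last _))
          · intro _
            simp
          · intro h
            simpa using hs.1 (by simpa using h)
        · refine Fin.lastCases ?_ (fun j => ?_) j
          · simpa using hpar
          · simpa using hs.2 j
      · intro s _ t _ h
        funext j
        have := congrFun h j.castSucc
        simp only [Fin.snoc_castSucc] at this
        exact Fin.castSucc_injective _ this
      · intro s hs
        simp only [Finset.mem_filter, Finset.mem_univ, true_and, isParityAlternating_iff] at hs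
        have hlt : ∀ j : Fin d, (s j.castSucc : ℕ) < N := fun j => by
          have h1 : s j.castSucc < s (Fin.last d) := hs.1.1 (Fin.castSucc_lt_last j)
          rw [hs.2] at h1
          exact h1
        refine ⟨fun j => ⟨s j.castSucc, hlt j⟩, ?_, ?_⟩
        · simp only [Finset.mem_filter, Finset.mem_univ, true_and, isParityAlternating_iff]
          exact ⟨fun a b hab => hs.1.1 (by simpa using hab), fun j => hs.1.2 j.castSucc⟩
        · funext j
          refine Fin.lastCases ?_ (fun j => ?_) j
          · simp [hs.2]
          · simp only [Fin.snoc_castSucc]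
            rfl
      · intro s _
        rw [Fin.prod_univ_castSucc]
        simp [mul_comm]
    · refine Finset.sum_eq_zero fun s hs => ?_
      simp only [Finset.mem_filter, Finset.mem_univ, true_and, isParityAlternating_iff] at hs
      have := hs.1.2 (Fin.last d)
      rw [hs.2] at this
      exact absurd (by simpa using this) hpar

theorem aeval_parityAltPoly {A : Type*} [CommRing A] [Algebra ℂ A] (y : ℕ → A) (N d : ℕ) :
    MvPolynomial.aeval (fun j : Fin N => y j) (parityAltPoly N d) = alt y N d := by
  induction N generalizing d with
  | zero =>
    cases d with
    | zero => simp [parityAltPoly_zero_right, alt]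
    | succ d => simp [parityAltPoly_zero_left, alt]
  | succ N ih =>
    cases d with
    | zero => simp [parityAltPoly_zero_right, alt]
    | succ d =>
      rw [parityAltPoly_succ, alt, map_add, MvPolynomial.aeval_rename, ← ih, ← ih]
      congr 1
      split_ifs
      · rw [map_mul, MvPolynomial.aeval_rename, MvPolynomial.aeval_X]
        rfl
      · simp

end Alternating

/-! ### Homogeneous components of words of elementary matrices -/

section Entries

variable {σ : Type}

theorem homogeneousComponent_mul_of_isHomogeneous {f g : Ser σ} {e : ℕ} (hg : g.IsHomogeneous e)
    (d : ℕ) : (f * g).homogeneousComponent (d + e) = f.homogeneousComponent d * g := by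
  classical
  ext m
  rw [MvPowerSeries.coeff_homogeneousComponent, MvPowerSeries.coeff_mul, MvPowerSeries.coeff_mul]
  split_ifs with h
  · refine Finset.sum_congr rfl fun p hp => ?_
    rw [MvPowerSeries.coeff_homogeneousComponent]
    rcases eq_or_ne (MvPowerSeries.coeff p.2 g) 0 with h0 | h0
    · simp [h0]
    · have h2 : p.2.degree = e := by
        by_contra hne
        exact h0 (hg.coeff_eq_zero hne)
      have h3 := congrArg Finsupp.degree (Finset.HasAntidiagonal.mem_antidiagonal.mp hp)
      rw [map_add] at h3
      rw [if_pos (by omega)]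
  · refine (Finset.sum_eq_zero fun p hp => ?_).symm
    rw [MvPowerSeries.coeff_homogeneousComponent]
    rcases eq_or_ne (MvPowerSeries.coeff p.2 g) 0 with h0 | h0
    · simp [h0]
    · have h2 : p.2.degree = e := by
        by_contra hne
        exact h0 (hg.coeff_eq_zero hne)
      have h3 := congrArg Finsupp.degree (Finset.HasAntidiagonal.mem_antidiagonal.mp hp)
      rw [map_add] at h3
      rw [if_neg (by omega), zero_mul]

theorem homogeneousComponent_mul_of_lt {f g : Ser σ} {e d : ℕ} (hg : g.IsHomogeneous e)
    (hd : d < e) : (f * g).homogeneousComponent d = 0 := by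
  classical
  ext m
  rw [MvPowerSeries.coeff_homogeneousComponent, MvPowerSeries.coeff_mul]
  split_ifs with h
  · refine Finset.sum_eq_zero fun p hp => ?_
    rcases eq_or_ne (MvPowerSeries.coeff p.2 g) 0 with h0 | h0
    · simp [h0]
    · have h2 : p.2.degree = e := by
        by_contra hne
        exact h0 (hg.coeff_eq_zero hne)
      have h3 := congrArg Finsupp.degree (Finset.HasAntidiagonal.mem_antidiagonal.mp hp)
      rw [map_add] at h3
      omega
  · rfl

theorem continuous_homogeneousComponent (d : ℕ) :
    Continuous fun f : Ser σ => f.homogeneousComponent d := by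
  refine continuous_pi fun m => ?_
  have : (fun f : Ser σ => (f.homogeneousComponent d) m) =
      fun f => if m.degree = d then MvPowerSeries.coeff m f else 0 := by
    funext f
    rw [← MvPowerSeries.coeff_homogeneousComponent]
    rfl
  rw [this]
  split_ifs
  · exact MvPowerSeries.WithPiTopology.continuous_coeff ℂ m
  · exact continuous_const

theorem homogeneousComponent_one (d : ℕ) :
    (1 : Ser σ).homogeneousComponent d = if d = 0 then 1 else 0 := by
  classical
  ext m
  rw [MvPowerSeries.coeff_homogeneousComponent, MvPowerSeries.coeff_one]
  by_cases hm : m = 0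
  · subst hm
    by_cases hd : d = 0
    · simp [hd]
    · simp [hd, Ne.symm hd]
  · by_cases hd : d = 0
    · simp [hd, hm, MvPowerSeries.coeff_one]
    · simp [hd, hm]

theorem coe_aeval {τ : Type} (g : τ → MvPolynomial σ ℂ) (p : MvPolynomial τ ℂ) :
    ((MvPolynomial.aeval g p : MvPolynomial σ ℂ) : Ser σ) =
      MvPolynomial.aeval (fun j => (g j : Ser σ)) p := by
  induction p using MvPolynomial.induction_on with
  | C a =>
    rw [MvPolynomial.aeval_C, MvPolynomial.aeval_C, MvPolynomial.algebraMap_eq,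
      MvPolynomial.coe_C]
    rfl
  | add p q hp hq => rw [map_add, map_add, MvPolynomial.coe_add, hp, hq]
  | mul_X p i hp =>
    rw [map_mul, map_mul, MvPolynomial.coe_mul, hp, MvPolynomial.aeval_X, MvPolynomial.aeval_X]

variable [Fintype σ]

theorem isHomogeneous_linForm (a : σ → ℂ) : (linForm a).IsHomogeneous 1 := by
  classical
  unfold MvPowerSeries.IsHomogeneous MvPowerSeries.IsWeightedHomogeneous
  intro m hm
  by_contra hne
  apply hm
  unfold linForm
  rw [map_sum]
  refine Finset.sum_eq_zero fun i _ => ?_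
  rw [MvPowerSeries.coeff_C_mul, MvPowerSeries.coeff_X, if_neg, mul_zero]
  rintro rfl
  exact hne (by simp [Finsupp.weight_single])

/-- The product of the first `N` alternating elementary matrices. -/
noncomputable def altWord (y : ℕ → σ → ℂ) : ℕ → Mat σ
  | 0 => 1
  | N + 1 => altWord y N * if N % 2 = 0 then upper (linForm (y N)) else lower (linForm (y N))

theorem altWord_congr {y z : ℕ → σ → ℂ} {N : ℕ} (h : ∀ i < N, y i = z i) :
    altWord y N = altWord z N := by
  induction N with
  | zero => rfl
  | succ N ih => rw [altWord, altWord, ih fun i hi => h i (by omega), h N (by omega)]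

/-- Each letter is completed to an upper-lower pair by a trivial letter of the other type; this is
the source of the factor 2. -/
theorem exists_altWord_eq {L : ℕ} {W : Mat σ} (hW : W ∈ letters σ ^ L) :
    ∃ y, W = altWord y (2 * L) := by
  induction L generalizing W with
  | zero =>
    rw [pow_zero, Set.mem_one] at hW
    exact ⟨0, hW⟩
  | succ L ih =>
    rw [pow_succ] at hW
    obtain ⟨V, hV, m, ⟨a, ha⟩, rfl⟩ := hW
    obtain ⟨y, rfl⟩ := ih hV
    have h0 : (2 * L) % 2 = 0 := by omega
    have h1 : ¬ (2 * L + 1) % 2 = 0 := by omega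
    rcases ha with rfl | rfl
    · refine ⟨fun i => if i < 2 * L then y i else if i = 2 * L then a else 0, ?_⟩
      show _ = altWord _ (2 * L + 1 + 1)
      rw [altWord, altWord, if_pos h0, if_neg h1,
        altWord_congr (z := y) fun i hi => if_pos hi]
      simp [linForm_zero, lower_zero]
    · refine ⟨fun i => if i < 2 * L then y i else if i = 2 * L + 1 then a else 0, ?_⟩
      show _ = altWord _ (2 * L + 1 + 1)
      rw [altWord, altWord, if_pos h0, if_neg h1,
        altWord_congr (z := y) fun i hi => if_pos hi]
      simp [linForm_zero, upper_zero]

/-- Right multiplication by U(y) adds y times the diagonal entry to the other entry of the first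
row, and L(y) does the reverse. Since the diagonal entry carries even degrees and the other one odd
degrees, this is exactly the recursion of `alt`. -/
theorem homogeneousComponent_altWord (y : ℕ → σ → ℂ) (N d : ℕ) :
    (altWord y N 0 0).homogeneousComponent d =
      (if d % 2 = 0 then alt (fun i => linForm (y i)) N d else 0) ∧
    (altWord y N 0 1).homogeneousComponent d =
      (if d % 2 = 1 then alt (fun i => linForm (y i)) N d else 0) := by
  induction N generalizing d with
  | zero =>
    cases d with
    | zero => simp [altWord, alt, homogeneousComponent_one]
    | succ d => simp [altWord, alt, homogeneousComponent_one]
  | succ N ih =>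
    have hl : (linForm (y N)).IsHomogeneous 1 := isHomogeneous_linForm (y N)
    rw [altWord]
    by_cases hN : N % 2 = 0
    · rw [if_pos hN]
      have e0 : (altWord y N * upper (linForm (y N))) 0 0 = altWord y N 0 0 := by
        simp [Matrix.mul_apply, Fin.sum_univ_two, upper]
      have e1 : (altWord y N * upper (linForm (y N))) 0 1 =
          altWord y N 0 1 + altWord y N 0 0 * linForm (y N) := by
        simp [Matrix.mul_apply, Fin.sum_univ_two, upper, add_comm]
      rw [e0, e1, map_add, (ih d).1, (ih d).2]
      cases d with
      | zero => simp [alt, homogeneousComponent_mul_of_lt hl]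
      | succ d =>
        rw [homogeneousComponent_mul_of_isHomogeneous hl, (ih d).1]
        by_cases hd : d % 2 = 0
        · have h1 : (d + 1) % 2 = 1 := by omega
          simp [h1, hd, alt, hN, mul_comm]
        · have h1 : (d + 1) % 2 = 0 := by omega
          have h2 : d % 2 = 1 := by omega
          simp [h1, h2, alt, hN]
    · rw [if_neg hN]
      have hN1 : N % 2 = 1 := by omega
      have e0 : (altWord y N * lower (linForm (y N))) 0 1 = altWord y N 0 1 := by
        simp [Matrix.mul_apply, Fin.sum_univ_two, lower]
      have e1 : (altWord y N * lower (linForm (y N))) 0 0 =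
          altWord y N 0 0 + altWord y N 0 1 * linForm (y N) := by
        simp [Matrix.mul_apply, Fin.sum_univ_two, lower]
      rw [e0, e1, map_add, (ih d).1, (ih d).2]
      cases d with
      | zero => simp [alt, homogeneousComponent_mul_of_lt hl]
      | succ d =>
        rw [homogeneousComponent_mul_of_isHomogeneous hl, (ih d).2]
        by_cases hd : d % 2 = 0
        · have h1 : (d + 1) % 2 = 1 := by omega
          simp [h1, hd, alt, hN1]
        · have h1 : (d + 1) % 2 = 0 := by omega
          have h2 : d % 2 = 1 := by omega
          simp [h1, h2, alt, hN1, mul_comm]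

theorem coe_linear (a : σ → ℂ) :
    ((∑ i, MvPolynomial.C (a i) * MvPolynomial.X i : MvPolynomial σ ℂ) : Ser σ) = linForm a := by
  rw [linForm]
  rw [← MvPolynomial.coeToMvPowerSeries.ringHom_apply, map_sum]
  simp

theorem coe_compLinear_parityAltPoly (y : ℕ → σ → ℂ) (N d : ℕ) :
    ((compLinear (parityAltPoly N d) (fun (j : Fin N) i => y j i) : MvPolynomial σ ℂ) : Ser σ) =
      alt (fun i => linForm (y i)) N d := by
  rw [← aeval_parityAltPoly (A := Ser σ)]
  refine (coe_aeval _ _).trans ?_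
  simp only [coe_linear]

/-- The polynomials `C_{N,d} ∘ A` for linear maps `A`, seen as power series. -/
def projections (σ : Type) [Fintype σ] (N d : ℕ) : Set (Ser σ) :=
  Set.range fun A : Matrix (Fin N) σ ℂ => ((compLinear (parityAltPoly N d) A : MvPolynomial σ ℂ) : Ser σ)

theorem homogeneousComponent_mem_projections {L : ℕ} {W : Mat σ} (hW : W ∈ letters σ ^ L) (d : ℕ) :
    (Even d → (W 0 0).homogeneousComponent d ∈ projections σ (2 * L) d) ∧
    (Odd d → (W 0 1).homogeneousComponent d ∈ projections σ (2 * L) d) ∧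
    (Even d → (W 0 1).homogeneousComponent d = 0) := by
  obtain ⟨y, rfl⟩ := exists_altWord_eq hW
  have h := homogeneousComponent_altWord y (2 * L) d
  refine ⟨fun hd => ?_, fun hd => ?_, fun hd => ?_⟩
  · rw [h.1, if_pos (Nat.even_iff.mp hd), ← coe_compLinear_parityAltPoly]
    exact ⟨_, rfl⟩
  · rw [h.2, if_pos (Nat.odd_iff.mp hd), ← coe_compLinear_parityAltPoly]
    exact ⟨_, rfl⟩
  · rw [h.2, if_neg (by rw [Nat.even_iff] at hd; omega)]

theorem Reaches.homogeneousComponent_mem {L : ℕ} {p : Ser σ} (hp : Reaches L p) {d : ℕ}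
    (hd : Odd d) : p.homogeneousComponent d ∈ closure (projections σ (2 * L) d) := by
  have : (upper p) 0 1 = p := by simp [upper]
  rw [← this]
  refine map_mem_closure (f := fun W : Mat σ => (W 0 1).homogeneousComponent d)
    ((continuous_homogeneousComponent d).comp (continuous_id.matrix_elem 0 1)) hp ?_
  exact fun W hW => (homogeneousComponent_mem_projections hW d).2.1 hd

theorem Reaches.homogeneousComponent_eq_zero {L : ℕ} {p : Ser σ} (hp : Reaches L p) {d : ℕ}
    (hd : Even d) : p.homogeneousComponent d = 0 := by
  have : (upper p) 0 1 = p := by simp [upper]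
  rw [← this]
  have h0 : IsClosed ({0} : Set (Ser σ)) := isClosed_singleton
  have := map_mem_closure (f := fun W : Mat σ => (W 0 1).homogeneousComponent d)
    ((continuous_homogeneousComponent d).comp (continuous_id.matrix_elem 0 1)) hp
    (t := {0}) fun W hW => (homogeneousComponent_mem_projections hW d).2.2 hd
  rwa [h0.closure_eq] at this

end Entries

/-! ## Limits of polynomials as closures in the ring of power series -/

section Closure

variable {σ : Type}

theorem firstCountable_ser [Countable σ] : FirstCountableTopology (Ser σ) :=
  inferInstanceAs (FirstCountableTopology ((σ →₀ ℕ) → ℂ))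

/-- Sequential limits are the closure because a countable product of copies of ℂ is first countable.
-/
theorem mem_limits_iff [Countable σ] {S : Set (MvPolynomial σ ℂ)} {f : MvPolynomial σ ℂ} :
    f ∈ limits S ↔
      (f : Ser σ) ∈ closure ((fun p : MvPolynomial σ ℂ => (p : Ser σ)) '' S) := by
  have := firstCountable_ser (σ := σ)
  rw [mem_closure_iff_seq_limit]
  constructor
  · rintro ⟨h, hS, hlim⟩
    refine ⟨fun k => (h k : Ser σ), fun k => ⟨h k, hS k, rfl⟩, ?_⟩
    rw [MvPowerSeries.WithPiTopology.tendsto_iff_coeff_tendsto]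
    exact hlim
  · rintro ⟨x, hx, hlim⟩
    choose h hS hh using hx
    refine ⟨h, hS, ?_⟩
    rw [MvPowerSeries.WithPiTopology.tendsto_iff_coeff_tendsto] at hlim
    intro m
    have := hlim m
    simp only [← hh] at this
    exact this

theorem subset_limits (S : Set (MvPolynomial σ ℂ)) : S ⊆ limits S :=
  fun f hf => ⟨fun _ => f, fun _ => hf, fun _ => tendsto_const_nhds⟩

theorem limits_mono {S T : Set (MvPolynomial σ ℂ)} (h : S ⊆ T) : limits S ⊆ limits T :=
  fun _ ⟨x, hx, hlim⟩ => ⟨x, fun k => h (hx k), hlim⟩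

theorem limits_limits_subset [Countable σ] (S : Set (MvPolynomial σ ℂ)) :
    limits (limits S) ⊆ limits S := by
  intro f hf
  rw [mem_limits_iff] at hf ⊢
  refine closure_minimal ?_ isClosed_closure hf
  rintro _ ⟨g, hg, rfl⟩
  exact mem_limits_iff.mp hg

theorem border_le {μ : MvPolynomial σ ℂ → ℕ∞} (f : MvPolynomial σ ℂ) : border μ f ≤ μ f := by
  rcases eq_or_ne (μ f) ⊤ with h | h
  · rw [h]
    exact le_top
  · obtain ⟨s, hs⟩ := ENat.ne_top_iff_exists.mp h
    rw [← hs, border, least_le_iff]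
    exact ⟨s, le_rfl, subset_limits _ hs.ge⟩

theorem mem_limits_of_border_le {μ : MvPolynomial σ ℂ → ℕ∞} {f : MvPolynomial σ ℂ} {s : ℕ}
    (h : border μ f ≤ s) : f ∈ limits {g | μ g ≤ (s : ℕ∞)} := by
  rw [border, least_le_iff] at h
  obtain ⟨t, hts, ht⟩ := h
  exact limits_mono (fun g (hg : μ g ≤ t) => hg.trans (by exact_mod_cast hts)) ht

theorem coe_homogeneousComponent (f : MvPolynomial σ ℂ) (d : ℕ) :
    ((MvPolynomial.homogeneousComponent d f : MvPolynomial σ ℂ) : Ser σ) =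
      (f : Ser σ).homogeneousComponent d := by
  ext m
  rw [MvPolynomial.coeff_coe, MvPolynomial.coeff_homogeneousComponent,
    MvPowerSeries.coeff_homogeneousComponent, MvPolynomial.coeff_coe]

/-- Since taking a component is continuous, bounds proved for a complexity measure pass to its
border version. -/
theorem homogeneousComponent_mem_closure [Countable σ] {S : Set (MvPolynomial σ ℂ)} {d : ℕ}
    {T : Set (Ser σ)} (hT : ∀ h ∈ S, (h : Ser σ).homogeneousComponent d ∈ closure T)
    {f : MvPolynomial σ ℂ} (hf : f ∈ limits S) :
    (f : Ser σ).homogeneousComponent d ∈ closure T := by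
  rw [mem_limits_iff] at hf
  have := map_mem_closure (continuous_homogeneousComponent d) hf (t := closure T) ?_
  · rwa [closure_closure] at this
  · rintro _ ⟨h, hS, rfl⟩
    exact hT h hS

end Closure

/-! ### Projections of the alternating polynomials, and sums of products in even degree -/

section Projections

theorem alt_congr {A : Type*} [CommRing A] {y z : ℕ → A} {N : ℕ} (h : ∀ i < N, y i = z i)
    (d : ℕ) : alt y N d = alt z N d := by
  induction N generalizing d with
  | zero => cases d <;> rfl
  | succ N ih =>
    cases d with
    | zero => rfl
    | succ d =>
      rw [alt, alt, ih (fun i hi => h i (by omega)), ih (fun i hi => h i (by omega)),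
        h N (by omega)]

theorem alt_of_zero {A : Type*} [CommRing A] {y : ℕ → A} {N M : ℕ} (hNM : N ≤ M)
    (h : ∀ i, N ≤ i → y i = 0) (d : ℕ) : alt y M d = alt y N d := by
  induction M, hNM using Nat.le_induction generalizing d with
  | base => rfl
  | succ M hM ih =>
    cases d with
    | zero => cases N <;> rfl
    | succ d => rw [alt, h M hM, zero_mul, ite_self, add_zero, ih]

theorem alt_smul {A : Type*} [CommRing A] (y : ℕ → A) (c : A) (N d : ℕ) :
    alt (fun i => c * y i) N d = c ^ d * alt y N d := by
  induction N generalizing d with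
  | zero => cases d <;> simp [alt]
  | succ N ih =>
    cases d with
    | zero => simp [alt]
    | succ d =>
      rw [alt, alt, ih, ih]
      split_ifs <;> ring

/-- The difference quotient of ∏ (1 + t x) at t = 0. It is polynomial in t and its value at 0 is the
derivative, which turns products into sums. -/
theorem exists_continuous_quotient {σ : Type} (l : List (Ser σ)) :
    ∃ Q : ℝ → Ser σ, Continuous Q ∧ Q 0 = l.sum ∧
      ∀ t : ℝ, (l.map fun x => 1 + MvPowerSeries.C (t : ℂ) * x).prod =
        1 + MvPowerSeries.C (t : ℂ) * Q t := by
  induction l with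
  | nil => exact ⟨fun _ => 0, continuous_const, by simp, by simp⟩
  | cons x l ih =>
    obtain ⟨Q, hQ, h0, h⟩ := ih
    refine ⟨fun t => x * (1 + MvPowerSeries.C (t : ℂ) * Q t) + Q t, ?_, ?_, fun t => ?_⟩
    · have hc := continuous_C_ofReal (σ := σ)
      exact (continuous_const.mul (continuous_const.add (hc.mul hQ))).add hQ
    · simp [h0]
    · rw [List.map_cons, List.prod_cons, h]
      ring

variable {σ : Type} [Fintype σ]

theorem mem_projections_iff {N d : ℕ} {x : Ser σ} :
    x ∈ projections σ N d ↔ ∃ y : ℕ → σ → ℂ, alt (fun i => linForm (y i)) N d = x := by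
  constructor
  · rintro ⟨A, rfl⟩
    refine ⟨fun i => if h : i < N then A ⟨i, h⟩ else 0, ?_⟩
    rw [← coe_compLinear_parityAltPoly]
    simp
  · rintro ⟨y, rfl⟩
    rw [← coe_compLinear_parityAltPoly]
    exact ⟨_, rfl⟩

theorem projections_mono {N M : ℕ} (h : N ≤ M) (d : ℕ) :
    projections σ N d ⊆ projections σ M d := by
  intro x hx
  rw [mem_projections_iff] at hx ⊢
  obtain ⟨y, rfl⟩ := hx
  refine ⟨fun i => if i < N then y i else 0, ?_⟩
  rw [alt_of_zero h (fun i hi => by simp only [if_neg (not_lt.mpr hi), linForm_zero])]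
  exact alt_congr (fun i hi => by simp only [if_pos hi]) d

theorem zero_mem_projections (N : ℕ) {d : ℕ} (hd : 0 < d) : 0 ∈ projections σ N d := by
  rw [mem_projections_iff]
  refine ⟨fun _ => 0, ?_⟩
  rw [alt_of_zero (Nat.zero_le N) fun i _ => linForm_zero]
  obtain ⟨d, rfl⟩ := Nat.exists_eq_succ_of_ne_zero hd.ne'
  rfl

/-- By homogeneity, scaling all linear forms by a d-th root of t scales the value by t. -/
theorem C_mul_mem_closure_projections {N d : ℕ} (hd : 0 < d) (t : ℂ) {x : Ser σ}
    (hx : x ∈ closure (projections σ N d)) :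
    MvPowerSeries.C t * x ∈ closure (projections σ N d) := by
  obtain ⟨c, hc⟩ := IsAlgClosed.exists_pow_nat_eq t hd
  refine map_mem_closure (continuous_const.mul continuous_id) hx fun z hz => ?_
  rw [mem_projections_iff] at hz ⊢
  obtain ⟨y, rfl⟩ := hz
  refine ⟨fun i => c • y i, ?_⟩
  simp only [← C_mul_linForm]
  rw [alt_smul, ← map_pow, hc]

theorem isDegeneration_iff {N d : ℕ} {f : MvPolynomial σ ℂ} :
    IsDegeneration f (parityAltPoly N d) ↔ (f : Ser σ) ∈ closure (projections σ N d) := by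
  rw [IsDegeneration, mem_limits_iff, ← Set.range_comp]
  rfl

/-- `![u, 0]` is a limit of first rows of products of `L` elementary matrices. -/
def RowReaches (L : ℕ) (u : Ser σ) : Prop :=
  ![u, 0] ∈ closure ((fun W : Mat σ => Matrix.vecMul ![1, 0] W) '' (letters σ ^ L))

theorem rowReaches_one : RowReaches 0 (1 : Ser σ) :=
  subset_closure ⟨1, by simp, by simp⟩

/-- The row (u, 0) times U(ta) L(b/t) U(-ta) equals (u(1 + ab), -t u a²b), and the second entry
vanishes as t → 0. Following only the first row is enough, since the second row of the product may
diverge. -/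
theorem RowReaches.mul_one_add {L T T' : ℕ} {u a b : Ser σ} (hu : RowReaches L u)
    (ha : Reaches T a) (hb : Reaches T' b) :
    RowReaches (L + (T + T' + T)) (u * (1 + a * b)) := by
  let c : ℝ → Ser σ := fun t => MvPowerSeries.C (t : ℂ)
  have hc : Continuous c := continuous_C_ofReal
  let r : ℝ → Fin 2 → Ser σ := fun t => ![u * (1 + a * b), - (c t * (u * a ^ 2 * b))]
  have hr : Continuous r := by
    refine continuous_pi fun i => ?_
    fin_cases i <;> simp [r] <;> fun_prop
  have h0 : r 0 = ![u * (1 + a * b), 0] := by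
    funext i; fin_cases i <;> simp [r, c]
  have hmem : ∀ t : ℝ, 0 < t → r t ∈
      closure ((fun W : Mat σ => Matrix.vecMul ![1, 0] W) '' (letters σ ^ (L + (T + T' + T)))) := by
    intro t ht
    have ht' : (t : ℂ) ≠ 0 := by exact_mod_cast ht.ne'
    have e : c t * MvPowerSeries.C (t : ℂ)⁻¹ = 1 := C_mul_C_inv ht'
    have hw := mul_mem_wordLimits (mul_mem_wordLimits (reaches_smul (t : ℂ) ha)
      (lower_mem_wordLimits (reaches_smul (t : ℂ)⁻¹ hb))) (reaches_smul (t : ℂ) ha).neg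
    have e1 : r t = Matrix.vecMul ![u, 0] (upper (c t * a) *
        lower (MvPowerSeries.C (t : ℂ)⁻¹ * b) * upper (-(c t * a))) := by
      set v : Ser σ := MvPowerSeries.C (t : ℂ)⁻¹
      refine funext fun i => ?_
      fin_cases i <;>
        simp [r, upper, lower, Matrix.vecMul, dotProduct, Matrix.mul_apply, Fin.sum_univ_two]
      · left
        linear_combination (-(a * b)) * e
      · linear_combination (u * a ^ 2 * b * c t) * e
    rw [e1]
    refine map_mem_closure₂ (f := fun (x : Fin 2 → Ser σ) (W : Mat σ) => Matrix.vecMul x W)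
      ?_ hu hw ?_
    · exact Continuous.matrix_vecMul continuous_fst continuous_snd
    · rintro _ ⟨V, hV, rfl⟩ W hW
      refine ⟨V * W, ?_, ?_⟩
      · rw [pow_add]
        exact Set.mul_mem_mul hV hW
      · simp only [Matrix.vecMul_vecMul]
  rw [RowReaches, ← h0]
  refine isClosed_closure.mem_of_tendsto (b := 𝓝[>] (0:ℝ)) (f := r)
    ((hr.tendsto 0).mono_left nhdsWithin_le_nhds) ?_
  filter_upwards [self_mem_nhdsWithin] with t ht using hmem t ht

theorem rowReaches_prod {T : ℕ} (l : List (Ser σ × Ser σ))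
    (hl : ∀ x ∈ l, Reaches T x.1 ∧ Reaches T x.2) :
    RowReaches (3 * T * l.length) (l.map fun x => 1 + x.1 * x.2).prod := by
  induction l with
  | nil => simpa using rowReaches_one
  | cons x l ih =>
    have h := (ih fun y hy => hl y (List.mem_cons_of_mem _ hy)).mul_one_add
      (hl x List.mem_cons_self).1 (hl x List.mem_cons_self).2
    rw [List.map_cons, List.prod_cons, mul_comm (1 + x.1 * x.2)]
    convert h using 1
    rw [List.length_cons]
    ring

theorem RowReaches.homogeneousComponent_mem {L : ℕ} {u : Ser σ} (hu : RowReaches L u) {d : ℕ}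
    (hd : Even d) : u.homogeneousComponent d ∈ closure (projections σ (2 * L) d) := by
  have : (![u, 0] : Fin 2 → Ser σ) 0 = u := rfl
  rw [← this]
  refine map_mem_closure (f := fun x : Fin 2 → Ser σ => (x 0).homogeneousComponent d)
    ((continuous_homogeneousComponent d).comp (continuous_apply 0)) hu ?_
  rintro _ ⟨W, hW, rfl⟩
  have e : Matrix.vecMul ![1, 0] W 0 = W 0 0 := by
    simp [Matrix.vecMul, dotProduct, Fin.sum_univ_two]
  simp only [e]
  exact (homogeneousComponent_mem_projections hW d).1 hd

/-- A sum of products of pairs of reachable series has its even components in the closure of the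
projections of `C`. -/
theorem homogeneousComponent_sum_mem {T : ℕ} (l : List (Ser σ × Ser σ))
    (hl : ∀ x ∈ l, Reaches T x.1 ∧ Reaches T x.2) {d : ℕ} (hd : Even d) (hd0 : 0 < d) :
    MvPowerSeries.homogeneousComponent d (l.map fun x => x.1 * x.2).sum ∈
      closure (projections σ (6 * T * l.length) d) := by
  obtain ⟨Q, hQ, h0, h⟩ := exists_continuous_quotient (l.map fun x => x.1 * x.2)
  rw [← h0]
  have hmem : ∀ t : ℝ, 0 < t →
      (Q t).homogeneousComponent d ∈ closure (projections σ (6 * T * l.length) d) := by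
    intro t ht
    have ht' : (t : ℂ) ≠ 0 := by exact_mod_cast ht.ne'
    have e := C_mul_C_inv (σ := σ) ht'
    -- The parameter t is absorbed into the first member of each pair. The word has length 3T per
    -- pair, and alternation doubles it, whence 6T.
    have h1 := rowReaches_prod (T := T) (l.map fun x : Ser σ × Ser σ => (MvPowerSeries.C (t : ℂ) * x.1, x.2)) (by
      intro x hx
      obtain ⟨y, hy, rfl⟩ := List.mem_map.mp hx
      exact ⟨reaches_smul _ (hl y hy).1, (hl y hy).2⟩)
    have h2 := C_mul_mem_closure_projections hd0 (t : ℂ)⁻¹ (h1.homogeneousComponent_mem hd)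
    have h3 := h t
    rw [List.map_map] at h3 h2
    have h4 : (fun x : Ser σ => 1 + MvPowerSeries.C (t : ℂ) * x) ∘ (fun x : Ser σ × Ser σ => x.1 * x.2) =
        (fun x : Ser σ × Ser σ => 1 + x.1 * x.2) ∘ fun x : Ser σ × Ser σ => (MvPowerSeries.C (t : ℂ) * x.1, x.2) := by
      funext x
      simp [mul_assoc]
    rw [h4] at h3
    rw [h3, map_add, homogeneousComponent_one, if_neg hd0.ne', zero_add,
      ← MvPowerSeries.smul_eq_C_mul, ← MvPowerSeries.smul_eq_C_mul, map_smul, smul_smul,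
      inv_mul_cancel₀ ht', one_smul, List.length_map] at h2
    convert h2 using 3
    ring
  refine isClosed_closure.mem_of_tendsto (b := 𝓝[>] (0:ℝ))
    (f := fun t => (Q t).homogeneousComponent d)
    ((((continuous_homogeneousComponent d).comp hQ).tendsto 0).mono_left nhdsWithin_le_nhds) ?_
  filter_upwards [self_mem_nhdsWithin] with t ht using hmem t ht

end Projections

/-! ## Formulas over the arity 3 basis -/

section Formulas

variable {σ : Type}

theorem Formula3.size_pos (φ : Formula3 σ) : 0 < φ.size := by
  cases φ <;> simp [Formula3.size]

theorem homogeneousComponent_eq_ite {f : MvPolynomial σ ℂ} {e : ℕ} (hf : f.IsHomogeneous e)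
    (d : ℕ) : (f : Ser σ).homogeneousComponent d = if d = e then (f : Ser σ) else 0 := by
  rw [← coe_homogeneousComponent, MvPolynomial.homogeneousComponent_of_mem hf]
  split_ifs <;> simp

/-- All children of the root have size less than `m`. -/
def Formula3.IsLight (m : ℕ) : Formula3 σ → Prop
  | .leaf _ => True
  | .add φ ψ => φ.size < m ∧ ψ.size < m
  | .mul φ ψ χ => φ.size < m ∧ ψ.size < m ∧ χ.size < m

variable [Fintype σ]

/-- A polynomial computed by a formula of size `s` written as `α * β * g + B`, where `g` is a
vertex of size at least `m` with small children, and `α`, `β`, `B` are computed by what is left of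
the formula when `g` is removed. -/
def SplitsAt (m s : ℕ) (p : MvPolynomial σ ℂ) : Prop :=
  ∃ g : Formula3 σ, m ≤ g.size ∧ g.IsLight m ∧ g.size ≤ s ∧
    ∃ B : MvPolynomial σ ℂ, (B = 0 ∨ ∃ ψ : Formula3 σ, ψ.eval = B ∧ ψ.size + g.size ≤ s) ∧
      (p = g.eval + B ∨ ∃ α β : Formula3 σ, α.size + β.size + g.size ≤ s ∧
        p = α.eval * β.eval * g.eval + B)

theorem SplitsAt.add {m s : ℕ} {p : MvPolynomial σ ℂ} (h : SplitsAt m s p) (ψ : Formula3 σ) :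
    SplitsAt m (s + ψ.size + 1) (p + ψ.eval) := by
  obtain ⟨g, hm, hl, hs, B, hB, hp⟩ := h
  refine ⟨g, hm, hl, by omega, B + ψ.eval, Or.inr ?_, ?_⟩
  · rcases hB with rfl | ⟨χ, rfl, hχ⟩
    · exact ⟨ψ, by simp, by omega⟩
    · exact ⟨.add χ ψ, rfl, by simp only [Formula3.size]; omega⟩
  · rcases hp with rfl | ⟨α, β, hs', rfl⟩
    · exact Or.inl (by ring)
    · exact Or.inr ⟨α, β, by omega, by ring⟩

/-- The new coefficient α β ψ χ of `g` is regrouped as (α β ψ) χ, so a product of two formulas still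
suffices. -/
theorem SplitsAt.mul {m s : ℕ} {p : MvPolynomial σ ℂ} (h : SplitsAt m s p) (ψ χ : Formula3 σ) :
    SplitsAt m (s + ψ.size + χ.size + 1) (p * ψ.eval * χ.eval) := by
  obtain ⟨g, hm, hl, hs, B, hB, hp⟩ := h
  refine ⟨g, hm, hl, by omega, B * ψ.eval * χ.eval, ?_, Or.inr ?_⟩
  · rcases hB with rfl | ⟨ξ, rfl, hξ⟩
    · exact Or.inl (by simp)
    · exact Or.inr ⟨.mul ξ ψ χ, rfl, by simp only [Formula3.size]; omega⟩
  · rcases hp with rfl | ⟨α, β, hs', rfl⟩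
    · exact ⟨ψ, χ, by omega, by ring⟩
    · refine ⟨.mul α β ψ, χ, by simp only [Formula3.size]; omega, ?_⟩
      simp only [Formula3.eval]
      ring

theorem splitsAt_self {m : ℕ} {φ : Formula3 σ} (hm : m ≤ φ.size) (hl : φ.IsLight m) :
    SplitsAt m φ.size φ.eval :=
  ⟨φ, hm, hl, le_rfl, 0, Or.inl rfl, Or.inl (by simp)⟩

/-- Descend from the root into a child of size at least m for as long as there is one. -/
theorem Formula3.splitsAt {m : ℕ} (φ : Formula3 σ) (h : m ≤ φ.size) :
    SplitsAt m φ.size φ.eval := by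
  induction φ with
  | leaf a => exact splitsAt_self h trivial
  | add φ ψ hφ hψ =>
    by_cases h1 : m ≤ φ.size
    · exact (hφ h1).add ψ
    by_cases h2 : m ≤ ψ.size
    · have := (hψ h2).add φ
      rwa [add_comm ψ.size, add_comm ψ.eval] at this
    · exact splitsAt_self h ⟨by omega, by omega⟩
  | mul φ ψ χ hφ hψ hχ =>
    by_cases h1 : m ≤ φ.size
    · exact (hφ h1).mul ψ χ
    by_cases h2 : m ≤ ψ.size
    · have := (hψ h2).mul φ χ
      rwa [add_comm ψ.size, mul_comm ψ.eval] at this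
    by_cases h3 : m ≤ χ.size
    · have := (hχ h3).mul φ ψ
      have e : χ.size + φ.size + ψ.size = φ.size + ψ.size + χ.size := by omega
      rwa [e, mul_assoc, mul_comm χ.eval] at this
    · exact splitsAt_self h ⟨by omega, by omega, by omega⟩

/-- Balancing by induction: split at a vertex `g` of size at least 2^n whose children are smaller.
What remains also has size below 2^n. In units of 32^n, `g` costs at most 4 + 4 + 2 = 10, and α β g
+ B costs 4 + 4 + 2 · 10 + 1 = 29, which is at most 32. -/
theorem Formula3.reaches_pow {n : ℕ} {φ : Formula3 σ} (h : φ.size < 2 ^ n) :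
    Reaches (32 ^ n) (φ.eval : Ser σ) := by
  induction n generalizing φ with
  | zero =>
    have := φ.size_pos
    omega
  | succ n ih =>
    have hpos : 0 < 32 ^ n := by positivity
    have h2 : 2 ^ (n + 1) = 2 * 2 ^ n := by ring
    rw [pow_succ 32]
    by_cases hn : φ.size < 2 ^ n
    · exact (ih hn).mono (by omega)
    obtain ⟨g, hm, hl, hs, B, hB, hp⟩ := φ.splitsAt (not_lt.mp hn)
    have hB' : Reaches (32 ^ n) (B : Ser σ) := by
      rcases hB with rfl | ⟨ψ, rfl, hψ⟩
      · simpa using reaches_zero _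
      · exact ih (by omega)
    have hg : Reaches (10 * 32 ^ n) (g.eval : Ser σ) := by
      cases g with
      | leaf a =>
        simp only [Formula3.eval, coe_linear]
        exact (reaches_linForm a).mono (by omega)
      | add ψ χ =>
        simp only [Formula3.eval, MvPolynomial.coe_add]
        exact ((ih hl.1).add (ih hl.2)).mono (by omega)
      | mul ψ χ ξ =>
        simp only [Formula3.eval, MvPolynomial.coe_mul]
        exact ((ih hl.1).mul3 (ih hl.2.1) (ih hl.2.2)).mono (by omega)
    rcases hp with hp | ⟨α, β, hs', hp⟩
    · rw [hp, MvPolynomial.coe_add]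
      exact (hg.add hB').mono (by omega)
    · rw [hp, MvPolynomial.coe_add, MvPolynomial.coe_mul, MvPolynomial.coe_mul]
      have := β.size_pos
      have := α.size_pos
      exact (((ih (by omega)).mul3 (ih (by omega)) hg).add hB').mono (by omega)

theorem Formula3.reaches (φ : Formula3 σ) {s : ℕ} (h : φ.size ≤ s) :
    Reaches ((2 * s) ^ 5) (φ.eval : Ser σ) := by
  have hs : s ≠ 0 := by have := φ.size_pos; omega
  refine (φ.reaches_pow (n := Nat.log 2 s + 1)
    (lt_of_le_of_lt h (Nat.lt_pow_succ_log_self (by norm_num) s))).mono ?_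
  calc 32 ^ (Nat.log 2 s + 1) = (2 ^ (Nat.log 2 s + 1)) ^ 5 := by
        rw [← pow_mul, mul_comm, pow_mul]; norm_num
    _ ≤ (2 * s) ^ 5 := by
        refine Nat.pow_le_pow_left ?_ 5
        rw [pow_succ, mul_comm]
        exact Nat.mul_le_mul_left 2 (Nat.pow_log_le_self 2 hs)

/-- Euler's formula for homogeneous polynomials. -/
theorem sum_X_mul_pderiv {f : MvPolynomial σ ℂ} {e : ℕ} (hf : f.IsHomogeneous e) :
    ∑ i, MvPolynomial.X i * MvPolynomial.pderiv i f = MvPolynomial.C (e : ℂ) * f := by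
  rw [hf.sum_X_mul_pderiv, nsmul_eq_mul, map_natCast]

/-- In odd degree the formula is reached directly. In even degree Euler's formula gives f = ∑ xᵢ
(d⁻¹ ∂ᵢf), a sum of products of two reached series. -/
theorem mem_closure_projections_of_formula3Size_le {f : MvPolynomial σ ℂ} {s d : ℕ}
    (hs : formula3Size f ≤ s) (hd : 0 < d) :
    (f : Ser σ).homogeneousComponent d ∈ closure (projections σ (6 * (2 * s) ^ 5 * s) d) := by
  have hzero := subset_closure (zero_mem_projections (σ := σ) (6 * (2 * s) ^ 5 * s) hd)
  obtain ⟨t, hts, ht⟩ := least_le_iff.mp hs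
  rcases ht with ⟨e, he, hf, φ, rfl, rfl⟩ | ⟨e, he, hf, φ, hφ, rfl⟩
  · rcases eq_or_ne d e with rfl | hne
    · refine closure_mono (projections_mono ?_ d) ((φ.reaches hts).homogeneousComponent_mem he)
      have := φ.size_pos
      have : (2 * s) ^ 5 * 1 ≤ (2 * s) ^ 5 * s := Nat.mul_le_mul_left _ (by omega)
      linarith [Nat.zero_le ((2 * s) ^ 5 * s), mul_assoc 6 ((2 * s) ^ 5) s]
    · rw [homogeneousComponent_eq_ite hf, if_neg hne]
      exact hzero
  · rcases eq_or_ne d e with rfl | hne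
    · let c : ℂ := (d : ℂ)⁻¹
      have hd' : (d : ℂ) ≠ 0 := by exact_mod_cast hd.ne'
      let l : List (Ser σ × Ser σ) := Finset.univ.toList.map fun i : σ =>
        (MvPowerSeries.X i, MvPowerSeries.C c * ((MvPolynomial.pderiv i f : MvPolynomial σ ℂ) : Ser σ))
      -- Every partial derivative has its own tree with at least one vertex, so there are at most s
      -- variables.
      have hlen : l.length ≤ s := by
        have h1 : l.length = ∑ i : σ, 1 := by simp [l]
        rw [h1]
        exact (Finset.sum_le_sum fun i _ => (φ i).size_pos).trans hts
      have hsum : (l.map fun x => x.1 * x.2).sum = (f : Ser σ) := by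
        have h1 : (l.map fun x => x.1 * x.2).sum = ∑ i : σ, MvPowerSeries.X i *
            (MvPowerSeries.C c * ((MvPolynomial.pderiv i f : MvPolynomial σ ℂ) : Ser σ)) := by
          simp only [l, List.map_map]
          exact Finset.sum_map_toList _ _
        have h2 := congrArg (fun p : MvPolynomial σ ℂ => MvPowerSeries.C c * (p : Ser σ))
          (sum_X_mul_pderiv hf)
        simp only [MvPolynomial.coe_mul, MvPolynomial.coe_C] at h2
        have e : (MvPowerSeries.C c * MvPowerSeries.C (d : ℂ) : Ser σ) = 1 := by
          rw [mul_comm]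
          exact C_mul_C_inv hd'
        rw [← mul_assoc, e, one_mul] at h2
        rw [h1, ← h2, ← MvPolynomial.coeToMvPowerSeries.ringHom_apply, map_sum, Finset.mul_sum]
        refine Finset.sum_congr rfl fun i _ => ?_
        rw [map_mul]
        simp only [MvPolynomial.coeToMvPowerSeries.ringHom_apply, MvPolynomial.coe_X]
        ring
      have hl : ∀ x ∈ l, Reaches ((2 * s) ^ 5) x.1 ∧ Reaches ((2 * s) ^ 5) x.2 := by
        intro x hx
        obtain ⟨i, _, rfl⟩ := List.mem_map.mp hx
        have hi : (φ i).size ≤ s :=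
          (Finset.single_le_sum (f := fun i => (φ i).size) (fun _ _ => Nat.zero_le _)
            (Finset.mem_univ i)).trans hts
        refine ⟨?_, ?_⟩
        · have := (φ i).size_pos
          exact (reaches_X i).mono (Nat.one_le_pow _ _ (by omega))
        · rw [← hφ]
          exact reaches_smul _ ((φ i).reaches hi)
      have := homogeneousComponent_sum_mem l hl he hd
      rw [hsum] at this
      exact closure_mono (projections_mono (Nat.mul_le_mul_left _ hlen) d) this
    · rw [homogeneousComponent_eq_ite hf, if_neg hne]
      exact hzero

end Formulas

theorem borderPHard_v3FClosure : BorderPHard parityAlt V3FClosure := by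
  rintro g ⟨-, hg⟩
  obtain ⟨k, hk⟩ := polyBounded_iff.mp hg
  refine ⟨fun n => 6 * (2 * (n + 2) ^ k) ^ 5 * (n + 2) ^ k, ?_, fun d n hd => ?_⟩
  · exact ⟨6 * (2 * (Polynomial.X + 2) ^ k) ^ 5 * (Polynomial.X + 2) ^ k, fun n => by simp⟩
  · refine isDegeneration_iff.mpr ?_
    rw [coe_homogeneousComponent]
    exact homogeneousComponent_mem_closure
      (fun h hh => mem_closure_projections_of_formula3Size_le hh hd)
      (mem_limits_of_border_le (hk n))

theorem v3F_subset_v3FClosure : V3F ⊆ V3FClosure := fun _ ⟨h1, q, hq⟩ =>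
  ⟨h1, q, fun n => (border_le _).trans (hq n)⟩

/-! ## Series split into an odd part and a short sum of products of odd series -/

section Split

variable {σ : Type} [Fintype σ]

/-- `p` is the sum of a reachable series, of a constant, and of at most `t` products of two
reachable series. -/
def IsSplit (t T : ℕ) (p : Ser σ) : Prop :=
  ∃ (o : Ser σ) (c : ℂ) (l : List (Ser σ × Ser σ)), Reaches T o ∧ l.length ≤ t ∧
    (∀ x ∈ l, Reaches T x.1 ∧ Reaches T x.2) ∧
    p = o + MvPowerSeries.C c + (l.map fun x => x.1 * x.2).sum

theorem IsSplit.mono {t t' T T' : ℕ} (ht : t ≤ t') (hT : T ≤ T') {p : Ser σ}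
    (hp : IsSplit t T p) : IsSplit t' T' p := by
  obtain ⟨o, c, l, ho, hlt, hl, rfl⟩ := hp
  exact ⟨o, c, l, ho.mono hT, hlt.trans ht,
    fun x hx => ⟨(hl x hx).1.mono hT, (hl x hx).2.mono hT⟩, rfl⟩

theorem isSplit_C (t T : ℕ) (c : ℂ) : IsSplit t T (MvPowerSeries.C c : Ser σ) :=
  ⟨0, c, [], reaches_zero T, Nat.zero_le t, by simp, by simp⟩

theorem isSplit_zero (t T : ℕ) : IsSplit t T (0 : Ser σ) := by
  simpa using isSplit_C (σ := σ) t T 0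

theorem isSplit_one (t T : ℕ) : IsSplit t T (1 : Ser σ) := by
  simpa using isSplit_C (σ := σ) t T 1

theorem isSplit_X (t : ℕ) {T : ℕ} (hT : 1 ≤ T) (i : σ) :
    IsSplit t T (MvPowerSeries.X i : Ser σ) :=
  ⟨MvPowerSeries.X i, 0, [], (reaches_X i).mono hT, Nat.zero_le t, by simp, by simp⟩

theorem IsSplit.add {t t' T T' : ℕ} {p q : Ser σ} (hp : IsSplit t T p) (hq : IsSplit t' T' q) :
    IsSplit (t + t') (T + T') (p + q) := by
  obtain ⟨o, c, l, ho, hlt, hl, rfl⟩ := hp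
  obtain ⟨o', c', l', ho', hlt', hl', rfl⟩ := hq
  refine ⟨o + o', c + c', l ++ l', ho.add ho', ?_, ?_, ?_⟩
  · rw [List.length_append]
    omega
  · intro x hx
    rcases List.mem_append.mp hx with h | h
    · exact ⟨(hl x h).1.mono (by omega), (hl x h).2.mono (by omega)⟩
    · exact ⟨(hl' x h).1.mono (by omega), (hl' x h).2.mono (by omega)⟩
  · rw [List.map_append, List.sum_append, map_add]
    ring

theorem IsSplit.sum {ι : Type*} (s : Finset ι) {t T : ℕ} {f : ι → Ser σ}
    (hf : ∀ i ∈ s, IsSplit t T (f i)) : IsSplit (s.card * t) (s.card * T) (∑ i ∈ s, f i) := by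
  classical
  induction s using Finset.induction_on with
  | empty => simpa using isSplit_zero 0 0
  | insert a s ha ih =>
    rw [Finset.sum_insert ha, Finset.card_insert_of_notMem ha]
    have := (hf a (Finset.mem_insert_self _ _)).add
      (ih fun i hi => hf i (Finset.mem_insert_of_mem hi))
    exact this.mono (by linarith) (by linarith)

/-- An odd series times a sum of pairs is a sum of ternary products, each of cost 4 + 4 + 2 = 10
times T. -/
theorem Reaches.mul_sum {T : ℕ} {r : Ser σ} (hr : Reaches T r) (l : List (Ser σ × Ser σ))
    (hl : ∀ x ∈ l, Reaches T x.1 ∧ Reaches T x.2) :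
    Reaches (10 * T * l.length) (r * (l.map fun x => x.1 * x.2).sum) := by
  induction l with
  | nil => simpa using reaches_zero _
  | cons x l ih =>
    have h1 := hl x List.mem_cons_self
    rw [List.map_cons, List.sum_cons, mul_add, ← mul_assoc, List.length_cons]
    exact ((hr.mul3 h1.1 h1.2).add (ih fun y hy => hl y (List.mem_cons_of_mem _ hy))).mono
      (by linarith)

/-- Write the factors as o + c + e and o' + c' + e', with e and e' the sums of pairs. The odd part c
o' + c' o + o e' + o' e costs at most T + T + 10tT + 10tT. The even part is o o' + c e' + e (c' +
e'); absorbing c' + e' into the second members of the pairs of e avoids t² pairs and leaves 2t + 1.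
-/
theorem IsSplit.mul {t T : ℕ} (ht : 1 ≤ t) {p q : Ser σ} (hp : IsSplit t T p)
    (hq : IsSplit t T q) : IsSplit (2 * t + 1) (22 * t * T) (p * q) := by
  obtain ⟨o, c, l, ho, hlt, hl, rfl⟩ := hp
  obtain ⟨o', c', l', ho', hlt', hl', rfl⟩ := hq
  have hT : T ≤ t * T := Nat.le_mul_of_pos_left T ht
  have hmul : ∀ {r : Ser σ}, Reaches T r → ∀ {m : List (Ser σ × Ser σ)}, m.length ≤ t →
      (∀ x ∈ m, Reaches T x.1 ∧ Reaches T x.2) →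
      Reaches (10 * (t * T)) (r * (m.map fun x => x.1 * x.2).sum) := by
    intro r hr m hm hm'
    refine (hr.mul_sum m hm').mono ?_
    calc 10 * T * m.length ≤ 10 * T * t := Nat.mul_le_mul_left _ hm
      _ = 10 * (t * T) := by ring
  have e22 : 22 * t * T = 22 * (t * T) := by ring
  rw [e22]
  refine ⟨MvPowerSeries.C c * o' + MvPowerSeries.C c' * o +
      o * (l'.map fun x => x.1 * x.2).sum + o' * (l.map fun x => x.1 * x.2).sum, c * c',
    (o, o') :: (l'.map (fun x => (MvPowerSeries.C c * x.1, x.2)) ++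
      l.map fun x => (x.1, MvPowerSeries.C c' * x.2 + x.2 * (l'.map fun x => x.1 * x.2).sum)),
    ?_, ?_, ?_, ?_⟩
  · exact ((((reaches_smul c ho').add (reaches_smul c' ho)).add (hmul ho hlt' hl')).add
      (hmul ho' hlt hl)).mono (by omega)
  · simp only [List.length_cons, List.length_append, List.length_map]
    omega
  · intro x hx
    rcases List.mem_cons.mp hx with rfl | hx
    · exact ⟨ho.mono (by omega), ho'.mono (by omega)⟩
    rcases List.mem_append.mp hx with hx | hx
    · obtain ⟨y, hy, rfl⟩ := List.mem_map.mp hx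
      exact ⟨(reaches_smul c (hl' y hy).1).mono (by omega), (hl' y hy).2.mono (by omega)⟩
    · obtain ⟨y, hy, rfl⟩ := List.mem_map.mp hx
      exact ⟨(hl y hy).1.mono (by omega),
        ((reaches_smul c' (hl y hy).2).add (hmul (hl y hy).2 hlt' hl')).mono (by omega)⟩
  · have h1 : ((l'.map (fun x => (MvPowerSeries.C c * x.1, x.2))).map
        fun x : Ser σ × Ser σ => x.1 * x.2).sum =
        MvPowerSeries.C c * (l'.map fun x => x.1 * x.2).sum := by
      rw [List.map_map, ← List.sum_map_mul_left]
      congr 1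
      refine List.map_congr_left fun x _ => ?_
      simp [mul_assoc]
    have h2 : ∀ e : Ser σ, ((l.map fun x => (x.1, MvPowerSeries.C c' * x.2 + x.2 * e)).map
        fun x : Ser σ × Ser σ => x.1 * x.2).sum =
        (MvPowerSeries.C c' + e) * (l.map fun x => x.1 * x.2).sum := by
      intro e
      rw [List.map_map, ← List.sum_map_mul_left]
      congr 1
      refine List.map_congr_left fun x _ => ?_
      simp only [Function.comp]
      ring
    rw [List.map_cons, List.sum_cons, List.map_append, List.sum_append, h1, h2, map_mul]
    ring

/-- Reached series have only odd degrees and products of two of them only even degrees, so parity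
selects either the odd part or the sum of pairs. -/
theorem IsSplit.homogeneousComponent_mem {t T : ℕ} (ht : 1 ≤ t) {p : Ser σ}
    (hp : IsSplit t T p) {d : ℕ} (hd : 0 < d) :
    p.homogeneousComponent d ∈ closure (projections σ (6 * t * T) d) := by
  obtain ⟨o, c, l, ho, hlt, hl, rfl⟩ := hp
  have hC : (MvPowerSeries.C c : Ser σ).homogeneousComponent d = 0 := by
    have h := homogeneousComponent_one (σ := σ) d
    rw [if_neg hd.ne'] at h
    rw [← mul_one (MvPowerSeries.C c), ← MvPowerSeries.smul_eq_C_mul, map_smul, h, smul_zero]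
  rw [map_add, map_add, hC, add_zero]
  rcases Nat.even_or_odd d with he | hodd
  · rw [ho.homogeneousComponent_eq_zero he, zero_add]
    refine closure_mono (projections_mono ?_ d) (homogeneousComponent_sum_mem l hl he hd)
    calc 6 * T * l.length ≤ 6 * T * t := Nat.mul_le_mul_left _ hlt
      _ = 6 * t * T := by ring
  · have hpair : ∀ x ∈ l, (x.1 * x.2).homogeneousComponent d = 0 := by
      classical
      intro x hx
      ext m
      rw [MvPowerSeries.coeff_homogeneousComponent, MvPowerSeries.coeff_mul]
      split_ifs with h
      · refine Finset.sum_eq_zero fun q hq => ?_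
        have h3 := congrArg Finsupp.degree (Finset.HasAntidiagonal.mem_antidiagonal.mp hq)
        rw [map_add, h] at h3
        rw [← h3, Nat.odd_add] at hodd
        have hcoeff : ∀ (a : Ser σ) (n : σ →₀ ℕ), Reaches T a → Even n.degree →
            MvPowerSeries.coeff n a = 0 := by
          intro a n ha hn
          have := congrArg (MvPowerSeries.coeff n) (ha.homogeneousComponent_eq_zero hn)
          rwa [MvPowerSeries.coeff_homogeneousComponent, if_pos rfl, map_zero] at this
        rcases Nat.even_or_odd q.1.degree with h1 | h1
        · rw [hcoeff _ _ (hl x hx).1 h1, zero_mul]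
        · rw [hcoeff _ _ (hl x hx).2 (hodd.mp h1), mul_zero]
      · rfl
    have hsum : MvPowerSeries.homogeneousComponent d (l.map fun x => x.1 * x.2).sum = 0 := by
      rw [map_list_sum, List.map_map]
      refine List.sum_eq_zero fun y hy => ?_
      obtain ⟨x, hx, rfl⟩ := List.mem_map.mp hy
      exact hpair x hx
    rw [hsum, add_zero]
    refine closure_mono (projections_mono ?_ d) (ho.homogeneousComponent_mem hodd)
    have : T ≤ t * T := Nat.le_mul_of_pos_left T ht
    linarith [mul_assoc 6 t T]

theorem exists_isSplit (p : MvPolynomial σ ℂ) :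
    ∃ t T : ℕ, 1 ≤ t ∧ 1 ≤ T ∧ IsSplit t T (p : Ser σ) := by
  induction p using MvPolynomial.induction_on with
  | C a => exact ⟨1, 1, le_rfl, le_rfl, by rw [MvPolynomial.coe_C]; exact isSplit_C 1 1 a⟩
  | add p q hp hq =>
    obtain ⟨t, T, ht, hT, hp⟩ := hp
    obtain ⟨t', T', ht', hT', hq⟩ := hq
    exact ⟨t + t', T + T', by omega, by omega, by rw [MvPolynomial.coe_add]; exact hp.add hq⟩
  | mul_X p i hp =>
    obtain ⟨t, T, ht, hT, hp⟩ := hp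
    refine ⟨2 * t + 1, 22 * t * T, by omega, ?_, ?_⟩
    · exact Nat.mul_pos (by omega) hT
    · rw [MvPolynomial.coe_mul, MvPolynomial.coe_X]
      exact hp.mul ht (isSplit_X t hT i)

/-- `IsSplit` with the parameters that bound sums of `N` products iterated `D` times. -/
def IsSplitLevel (N D : ℕ) (p : Ser σ) : Prop := IsSplit ((22 * N) ^ D) ((22 * N) ^ D ^ 2) p

theorem IsSplitLevel.mono {N D D' : ℕ} (hN : 1 ≤ N) (hD : D ≤ D') {p : Ser σ}
    (hp : IsSplitLevel N D p) : IsSplitLevel N D' p :=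
  IsSplit.mono (Nat.pow_le_pow_right (by omega) hD)
    (Nat.pow_le_pow_right (by omega) (Nat.pow_le_pow_left hD 2)) hp

/-- A level multiplies t by at most 22N and T by at most 22Nt. As t is itself (22N)^D, the exponent
of T grows by D + 1, which the square D² absorbs. -/
theorem IsSplitLevel.sum_mul {ι : Type*} [Fintype ι] {N D : ℕ} (hN : 1 ≤ N)
    (hι : Fintype.card ι ≤ N) {f g : ι → Ser σ} (hf : ∀ i, IsSplitLevel N D (f i))
    (hg : ∀ i, IsSplitLevel N D (g i)) : IsSplitLevel N (D + 1) (∑ i, f i * g i) := by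
  have ht : 1 ≤ (22 * N) ^ D := Nat.one_le_pow _ _ (by omega)
  refine (IsSplit.sum Finset.univ fun i _ => (hf i).mul ht (hg i)).mono ?_ ?_
  · rw [Finset.card_univ]
    calc Fintype.card ι * (2 * (22 * N) ^ D + 1) ≤ N * (22 * (22 * N) ^ D) :=
          Nat.mul_le_mul hι (by omega)
      _ = (22 * N) ^ (D + 1) := by ring
  · rw [Finset.card_univ]
    calc Fintype.card ι * (22 * (22 * N) ^ D * (22 * N) ^ D ^ 2)
        ≤ N * (22 * (22 * N) ^ D * (22 * N) ^ D ^ 2) := Nat.mul_le_mul_right _ hι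
      _ = (22 * N) ^ (D ^ 2 + D + 1) := by ring
      _ ≤ (22 * N) ^ (D + 1) ^ 2 := Nat.pow_le_pow_right (by omega) (by nlinarith)

end Split

/-! ## Newton iteration for the equations of a circuit -/

namespace Circuit

variable {σ : Type} (Γ : Circuit σ)

/-- The right hand sides of the equations of a circuit. -/
noncomputable def step (S : Fin Γ.size → Ser σ) (i : Fin Γ.size) : Ser σ :=
  match Γ.gate i with
  | .var x => MvPowerSeries.X x
  | .const a => MvPowerSeries.C a
  | .add j k => S ⟨j, j.2.trans i.2⟩ + S ⟨k, k.2.trans i.2⟩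
  | .mul j k => S ⟨j, j.2.trans i.2⟩ * S ⟨k, k.2.trans i.2⟩

/-- The Jacobian matrix of `step`. -/
noncomputable def jac (S : Fin Γ.size → Ser σ) : Matrix (Fin Γ.size) (Fin Γ.size) (Ser σ) :=
  fun i u =>
  match Γ.gate i with
  | .var _ => 0
  | .const _ => 0
  | .add j k => (if (u : ℕ) = j then 1 else 0) * 1 + (if (u : ℕ) = k then 1 else 0) * 1
  | .mul j k => (if (u : ℕ) = j then 1 else 0) * S ⟨k, k.2.trans i.2⟩ +
      (if (u : ℕ) = k then 1 else 0) * S ⟨j, j.2.trans i.2⟩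

/-- The values of the gates as power series. -/
noncomputable def ser (i : Fin Γ.size) : Ser σ := (Γ.value i : MvPolynomial σ ℂ)

theorem step_ser : Γ.step Γ.ser = Γ.ser := by
  funext i
  have hv := Circuit.value.eq_1 Γ i
  unfold step
  cases h : Γ.gate i <;> simp only [h] at hv <;> simp [ser, hv]

theorem sum_ite_mul {s : ℕ} {A : Type*} [CommRing A] (j : ℕ) (hj : j < s) (c : A) (E : Fin s → A) :
    ∑ u : Fin s, (if (u : ℕ) = j then 1 else 0) * c * E u = c * E ⟨j, hj⟩ := by
  rw [Finset.sum_eq_single ⟨j, hj⟩]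
  · simp
  · intro u _ hu
    rw [if_neg (fun h => hu (Fin.ext h))]
    simp
  · simp

/-- Taylor expansion: the equations are at most quadratic, so the remainder at a product gate is the
product of the two increments. -/
theorem step_sub_step (J : Ideal (Ser σ)) {S V : Fin Γ.size → Ser σ} (h : ∀ i, V i - S i ∈ J) :
    ∃ B : Fin Γ.size → Ser σ, (∀ i, B i ∈ J * J) ∧
      Γ.step V - Γ.step S = (Γ.jac S).mulVec (V - S) + B := by
  refine ⟨Γ.step V - Γ.step S - (Γ.jac S).mulVec (V - S), fun i => ?_, by abel⟩
  simp only [Pi.sub_apply, Matrix.mulVec, dotProduct, step, jac]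
  split
  · simp
  · simp
  · next j k _ =>
    simp only [add_mul, Finset.sum_add_distrib]
    rw [sum_ite_mul _ (j.2.trans i.2) _ fun u => V u - S u,
      sum_ite_mul _ (k.2.trans i.2) _ fun u => V u - S u]
    ring_nf
    simp
  · next j k _ =>
    simp only [add_mul, Finset.sum_add_distrib]
    rw [sum_ite_mul _ (j.2.trans i.2) _ fun u => V u - S u,
      sum_ite_mul _ (k.2.trans i.2) _ fun u => V u - S u]
    convert Ideal.mul_mem_mul (h ⟨j, j.2.trans i.2⟩) (h ⟨k, k.2.trans i.2⟩) using 1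
    ring

/-- Gates use only earlier gates, so the Jacobian is strictly lower triangular. -/
theorem jac_pow_apply_eq_zero (S : Fin Γ.size → Ser σ) (n : ℕ) (i u : Fin Γ.size)
    (h : (i : ℕ) < u + n) : (Γ.jac S ^ n) i u = 0 := by
  induction n generalizing u with
  | zero =>
    rw [pow_zero, Matrix.one_apply_ne]
    rintro rfl
    omega
  | succ n ih =>
    rw [pow_succ, Matrix.mul_apply]
    refine Finset.sum_eq_zero fun w _ => ?_
    by_cases hw : (i : ℕ) < w + n
    · rw [ih w hw, zero_mul]
    · have hjac : Γ.jac S w u = 0 := by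
        simp only [jac]
        split
        · rfl
        · rfl
        · next j k _ =>
          have := j.2
          have := k.2
          rw [if_neg (by omega), if_neg (by omega)]
          simp
        · next j k _ =>
          have := j.2
          have := k.2
          rw [if_neg (by omega), if_neg (by omega)]
          simp
      rw [hjac, mul_zero]

theorem jac_pow_eq_zero (S : Fin Γ.size → Ser σ) {n : ℕ} (h : Γ.size ≤ n) : Γ.jac S ^ n = 0 := by
  ext1 i u
  exact Γ.jac_pow_apply_eq_zero S n i u (by omega)

/-- One step of the Newton iteration. -/
noncomputable def newton (l : ℕ) (S : Fin Γ.size → Ser σ) : Fin Γ.size → Ser σ :=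
  S + (∑ j ∈ Finset.range (2 ^ l), Γ.jac S ^ j).mulVec (Γ.step S - S)

/-- The true values are a fixed point of `step`, so the residual at S is (1 - jac)(ser - S) minus a
quadratic remainder. The geometric sum inverts 1 - jac by nilpotence, and only the remainder
survives. -/
theorem ser_sub_newton_mem {l : ℕ} (hl : Γ.size ≤ 2 ^ l) (J : Ideal (Ser σ))
    {S : Fin Γ.size → Ser σ} (h : ∀ i, Γ.ser i - S i ∈ J) (i : Fin Γ.size) :
    Γ.ser i - Γ.newton l S i ∈ J * J := by
  obtain ⟨B, hB, hstep⟩ := Γ.step_sub_step J h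
  rw [step_ser] at hstep
  set Y := ∑ j ∈ Finset.range (2 ^ l), Γ.jac S ^ j with hY
  have hinv : Y * (1 - Γ.jac S) = 1 := by
    have := geom_sum_mul (Γ.jac S) (2 ^ l)
    rw [Γ.jac_pow_eq_zero S hl, ← hY] at this
    rw [← neg_sub, mul_neg, this]
    simp
  have e1 : Γ.step S - S = (1 - Γ.jac S).mulVec (Γ.ser - S) - B := by
    rw [Matrix.sub_mulVec, Matrix.one_mulVec]
    have : Γ.step S = Γ.ser - ((Γ.jac S).mulVec (Γ.ser - S) + B) := by rw [← hstep]; abel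
    rw [this]
    abel
  have e2 : Γ.ser - Γ.newton l S = Y.mulVec B := by
    rw [newton, ← hY, e1, Matrix.mulVec_sub, Matrix.mulVec_mulVec, hinv, Matrix.one_mulVec]
    abel
  have e3 := congrFun e2 i
  rw [Pi.sub_apply] at e3
  rw [e3]
  show ∑ u, Y i u * B u ∈ J * J
  exact Ideal.sum_mem _ fun u _ => Ideal.mul_mem_left _ _ (hB u)

theorem ser_sub_newton_iterate_mem {l : ℕ} (hl : Γ.size ≤ 2 ^ l) (J : Ideal (Ser σ))
    {S : Fin Γ.size → Ser σ} (h : ∀ i, Γ.ser i - S i ∈ J) (r : ℕ) (i : Fin Γ.size) :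
    Γ.ser i - (Γ.newton l)^[r] S i ∈ J ^ 2 ^ r := by
  induction r generalizing i with
  | zero => simpa using h i
  | succ r ih =>
    rw [Function.iterate_succ_apply', pow_succ 2, pow_mul, pow_two]
    exact Γ.ser_sub_newton_mem hl _ ih i

variable [Fintype σ]

/-- One level pays for the Jacobian and the residual, one for each of the l doublings of the
geometric sum, and one for the final addition. -/
theorem isSplitLevel_newton {N D l : ℕ} (hN : Γ.size + 2 ≤ N) {S : Fin Γ.size → Ser σ}
    (hS : ∀ i, IsSplitLevel N D (S i)) (i : Fin Γ.size) :
    IsSplitLevel N (D + (l + 2)) (Γ.newton l S i) := by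
  have h0 : ∀ D, IsSplitLevel N D (0 : Ser σ) := fun D => isSplit_zero _ _
  have h1 : ∀ D, IsSplitLevel N D (1 : Ser σ) := fun D => isSplit_one _ _
  have hneg : ∀ D, IsSplitLevel N D (-1 : Ser σ) := fun D => by
    have := isSplit_C (σ := σ) ((22 * N) ^ D) ((22 * N) ^ D ^ 2) (-1)
    rwa [map_neg, map_one] at this
  have hite : ∀ D (P : Prop) [Decidable P], IsSplitLevel N D (if P then 1 else 0 : Ser σ) := by
    intro D P _
    split_ifs
    · exact h1 D
    · exact h0 D
  have hN1 : 1 ≤ N := by omega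
  have two : ∀ {D : ℕ} {a b c d : Ser σ}, IsSplitLevel N D a → IsSplitLevel N D b →
      IsSplitLevel N D c → IsSplitLevel N D d → IsSplitLevel N (D + 1) (a * b + c * d) := by
    intro D a b c d ha hb hc hd
    have := IsSplitLevel.sum_mul (ι := Fin 2) (f := ![a, c]) (g := ![b, d]) hN1
      (by simp; omega) (D := D) (by intro i; fin_cases i <;> assumption)
      (by intro i; fin_cases i <;> assumption)
    simpa using this
  have hjac : ∀ i u, IsSplitLevel N (D + 1) (Γ.jac S i u) := by
    intro i u
    simp only [jac]
    split
    · exact h0 _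
    · exact h0 _
    · exact two (hite _ _) (h1 _) (hite _ _) (h1 _)
    · exact two (hite _ _) (hS _) (hite _ _) (hS _)
  have hpow : ∀ n i u, IsSplitLevel N (D + 1 + n) ((Γ.jac S ^ 2 ^ n) i u) := by
    intro n
    induction n with
    | zero => simpa using hjac
    | succ n ih =>
      intro i u
      rw [pow_succ 2, pow_mul, pow_two, Matrix.mul_apply]
      exact IsSplitLevel.sum_mul hN1 (by simp; omega) (fun w => ih i w) fun w => ih w u
  have hres : ∀ i, IsSplitLevel N (D + 1) ((Γ.step S - S) i) := by
    intro i
    rw [Pi.sub_apply]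
    have three : ∀ {a b : Ser σ}, IsSplitLevel N D a → IsSplitLevel N D b →
        IsSplitLevel N (D + 1) (a * b - S i) := by
      intro a b ha hb
      have := two ha hb (hneg D) (hS i)
      rwa [neg_one_mul, ← sub_eq_add_neg] at this
    simp only [step]
    split
    · next x _ =>
      rw [← mul_one (MvPowerSeries.X x)]
      refine three (isSplit_X _ (Nat.one_le_pow _ _ (by omega)) x) (h1 D)
    · next a _ =>
      rw [← mul_one (MvPowerSeries.C a)]
      exact three (isSplit_C _ _ a) (h1 D)
    · next j k _ =>
      have := IsSplitLevel.sum_mul (ι := Fin 3) (f := ![1, 1, -1])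
        (g := ![S ⟨j, j.2.trans i.2⟩, S ⟨k, k.2.trans i.2⟩, S i]) hN1
        (by simp; have := i.2; omega) (D := D)
        (by intro i; fin_cases i; exacts [h1 D, h1 D, hneg D])
        (by intro i; fin_cases i <;> exact hS _)
      simpa [Fin.sum_univ_three, sub_eq_add_neg] using this
    · exact three (hS _) (hS _)
  have hvec : ∀ n i, IsSplitLevel N (D + 1 + n)
      ((∑ j ∈ Finset.range (2 ^ n), Γ.jac S ^ j).mulVec (Γ.step S - S) i) := by
    intro n
    induction n with
    | zero => simpa using hres
    | succ n ih =>
      intro i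
      have e : ∑ j ∈ Finset.range (2 ^ (n + 1)), Γ.jac S ^ j =
          ∑ j ∈ Finset.range (2 ^ n), Γ.jac S ^ j +
            Γ.jac S ^ 2 ^ n * ∑ j ∈ Finset.range (2 ^ n), Γ.jac S ^ j := by
        rw [pow_succ 2, mul_two, Finset.sum_range_add, Finset.mul_sum]
        simp only [pow_add]
      rw [e, Matrix.add_mulVec, ← Matrix.mulVec_mulVec]
      -- The index `none` carries the summand that is merely added, so addition and matrix-vector
      -- product share one level of size + 1 products.
      have := IsSplitLevel.sum_mul (ι := Option (Fin Γ.size)) hN1 (by simp; omega)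
        (f := fun o => o.elim 1 fun u => (Γ.jac S ^ 2 ^ n) i u)
        (g := fun o => o.elim ((∑ j ∈ Finset.range (2 ^ n), Γ.jac S ^ j).mulVec (Γ.step S - S) i)
          fun u => (∑ j ∈ Finset.range (2 ^ n), Γ.jac S ^ j).mulVec (Γ.step S - S) u)
        (D := D + 1 + n) (by
          rintro (_ | u)
          · exact h1 _
          · exact hpow n i u) (by
          rintro (_ | u)
          · exact ih i
          · exact ih u)
      rw [Fintype.sum_option] at this
      simp only [Option.elim, one_mul] at this
      exact this
  have hfin := two ((hS i).mono hN1 (show D ≤ D + 1 + l by omega)) (h1 _) (hvec l i) (h1 _)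
  rw [mul_one, mul_one, show D + 1 + l + 1 = D + (l + 2) by omega] at hfin
  exact hfin

/-- The iteration starts at the constant terms, which are at level 0. The initial error has no
constant term, so after r steps it lies in the 2^r-th power of that ideal and has order at least
2^r. -/
theorem exists_isSplitLevel {N l : ℕ} (hN : Γ.size + 2 ≤ N) (hl : Γ.size ≤ 2 ^ l) (r : ℕ)
    (i : Fin Γ.size) :
    ∃ p : Ser σ, IsSplitLevel N (r * (l + 2)) p ∧
      ∀ d < 2 ^ r, p.homogeneousComponent d = (Γ.ser i).homogeneousComponent d := by
  set S : Fin Γ.size → Ser σ := fun i => MvPowerSeries.C (MvPowerSeries.constantCoeff (Γ.ser i))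
  set J : Ideal (Ser σ) := RingHom.ker MvPowerSeries.constantCoeff
  have hJ : ∀ i, Γ.ser i - S i ∈ J := fun i => by simp [J, S, RingHom.mem_ker]
  refine ⟨(Γ.newton l)^[r] S i, ?_, fun d hd => ?_⟩
  · clear hJ
    induction r generalizing i with
    | zero => exact isSplit_C _ _ _
    | succ r ih =>
      rw [Function.iterate_succ_apply', Nat.succ_mul]
      exact Γ.isSplitLevel_newton hN ih i
  · have hmem := Γ.ser_sub_newton_iterate_mem hl J hJ r i
    have hord : ∀ n : ℕ, ∀ x ∈ J ^ n, (n : ℕ∞) ≤ x.order := by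
      intro n
      induction n with
      | zero => simp
      | succ n ih =>
        intro x hx
        rw [pow_succ] at hx
        refine Submodule.mul_induction_on hx (fun a ha b hb => ?_) fun a b ha hb => ?_
        · have h1 : (1 : ℕ∞) ≤ b.order :=
            MvPowerSeries.one_le_order_iff_constCoeff_eq_zero.mpr hb
          push_cast
          exact (add_le_add (ih a ha) h1).trans MvPowerSeries.le_order_mul
        · exact (le_min ha hb).trans MvPowerSeries.min_order_le_add
    have h0 := MvPowerSeries.homogeneousComponent_of_lt_order_eq_zero
      (lt_of_lt_of_le (by exact_mod_cast hd) (hord _ _ hmem) : (d : ℕ∞) < _)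
    rw [map_sub, sub_eq_zero] at h0
    exact h0.symm

end Circuit

/-! ## Hardness for quasipolynomial circuits -/

/-- The level is r(l + 2) with base 22(2^l + 2) ≤ 2^(l + 7). The bound is quasipolynomial because l
and r are logarithms of size and degree. -/
theorem mem_closure_projections_of_circuitSize_le {σ : Type} [Fintype σ] {f : MvPolynomial σ ℂ}
    {l r d : ℕ} (hs : circuitSize f ≤ ((2 ^ l : ℕ) : ℕ∞)) (hd : 0 < d) (hdr : d < 2 ^ r) :
    (f : Ser σ).homogeneousComponent d ∈ closure (projections σ
      (2 ^ ((l + 7) * (r * (l + 2) + (r * (l + 2)) ^ 2) + 3)) d) := by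
  obtain ⟨t, hts, Γ, rfl, rfl⟩ := least_le_iff.mp hs
  obtain ⟨p, hp, hpd⟩ := Γ.exists_isSplitLevel (N := 2 ^ l + 2) (by omega) hts r Γ.output
  have h := IsSplit.homogeneousComponent_mem (Nat.one_le_pow _ _ (by omega)) hp hd
  rw [hpd d hdr] at h
  refine closure_mono (projections_mono ?_ d) h
  set D := r * (l + 2)
  have h1 : 22 * (2 ^ l + 2) ≤ 2 ^ (l + 7) := by
    have : 1 ≤ 2 ^ l := Nat.one_le_two_pow
    rw [pow_add]
    omega
  calc 6 * (22 * (2 ^ l + 2)) ^ D * (22 * (2 ^ l + 2)) ^ D ^ 2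
      = 6 * (22 * (2 ^ l + 2)) ^ (D + D ^ 2) := by rw [mul_assoc, ← pow_add]
    _ ≤ 2 ^ 3 * (2 ^ (l + 7)) ^ (D + D ^ 2) :=
        Nat.mul_le_mul (by norm_num) (Nat.pow_le_pow_left h1 _)
    _ = _ := by rw [← pow_mul, ← pow_add, add_comm]

theorem add_two_pow_le (n k : ℕ) : (n + 2) ^ k ≤ 2 ^ ((Nat.log 2 n + 2) * k) := by
  rw [pow_mul]
  refine Nat.pow_le_pow_left ?_ k
  have := Nat.lt_pow_succ_log_self (b := 2) (by norm_num) n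
  have h2 : 2 ≤ 2 ^ (Nat.log 2 n + 1) := by
    rw [pow_succ]
    have : 1 ≤ 2 ^ Nat.log 2 n := Nat.one_le_two_pow
    omega
  rw [Nat.succ_eq_add_one] at this
  have h3 : 2 ^ (Nat.log 2 n + 2) = 2 * 2 ^ (Nat.log 2 n + 1) := by ring
  omega

theorem quasiPolyBounded_of_le_two_pow {c : ℕ → ℕ∞} (P : Polynomial ℕ)
    (h : ∀ n, 2 ≤ n → c n ≤ ((2 ^ P.eval (Nat.log 2 n) : ℕ) : ℕ∞)) : QuasiPolyBounded c := by
  obtain ⟨k, hk⟩ := exists_eval_le_pow P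
  refine quasiPolyBounded_iff.mpr ⟨k, fun n hn => (h n hn).trans ?_⟩
  exact_mod_cast Nat.pow_le_pow_right (by norm_num) (hk _)

theorem borderQPHard_vqpClosure : BorderQPHard parityAlt VQPClosure := by
  intro g hg
  obtain ⟨k, hk⟩ := quasiPolyBounded_iff.mp hg
  obtain ⟨m, hm⟩ := polyBounded_iff.mp g.degree_bounded
  let l : Polynomial ℕ := (Polynomial.X + 2) ^ k
  -- The summand 1 makes 2^r strictly larger than the degree.
  let r : Polynomial ℕ := (Polynomial.X + 2) * (m : Polynomial ℕ) + 1
  let P : Polynomial ℕ := (l + 7) * (r * (l + 2) + (r * (l + 2)) ^ 2) + 3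
  have hex : ∀ n, ∃ q : ℕ, (2 ≤ n → q = 2 ^ P.eval (Nat.log 2 n)) ∧ ∀ d, 0 < d →
      IsDegeneration (MvPolynomial.homogeneousComponent d (g.poly n)) (parityAltPoly q d) := by
    intro n
    by_cases hn : 2 ≤ n
    · refine ⟨2 ^ P.eval (Nat.log 2 n), fun _ => rfl, fun d hd => ?_⟩
      rw [isDegeneration_iff]
      by_cases hdeg : d ≤ (g.poly n).totalDegree
      · rw [coe_homogeneousComponent]
        have hdr : d < 2 ^ ((Nat.log 2 n + 2) * m + 1) := by
          have h1 : (g.poly n).totalDegree ≤ (n + 2) ^ m := by exact_mod_cast hm n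
          have h2 := add_two_pow_le n m
          have h3 : 2 ^ ((Nat.log 2 n + 2) * m) < 2 ^ ((Nat.log 2 n + 2) * m + 1) :=
            Nat.pow_lt_pow_right (by norm_num) (by omega)
          omega
        have := homogeneousComponent_mem_closure
          (fun h hh => mem_closure_projections_of_circuitSize_le hh hd hdr)
          (mem_limits_of_border_le (hk n hn))
        simpa [P, l, r] using this
      · rw [MvPolynomial.homogeneousComponent_eq_zero _ _ (not_le.mp hdeg), MvPolynomial.coe_zero]
        exact subset_closure (zero_mem_projections _ hd)
    -- Quasipolynomial bounds say nothing for n < 2, but a degeneration is still required there; any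
    -- finite q will do.
    · obtain ⟨t, T, ht, -, h⟩ := exists_isSplit (g.poly n)
      refine ⟨6 * t * T, fun h => absurd h hn, fun d hd => ?_⟩
      rw [isDegeneration_iff, coe_homogeneousComponent]
      exact h.homogeneousComponent_mem ht hd
  choose q hq hdeg using hex
  exact ⟨q, quasiPolyBounded_of_le_two_pow P fun n hn => by rw [hq n hn],
    fun d n hd => hdeg n d hd⟩

theorem vqp_subset_vqpClosure : VQP ⊆ VQPClosure := by
  intro f hf
  obtain ⟨k, hk⟩ := quasiPolyBounded_iff.mp hf
  exact quasiPolyBounded_iff.mpr ⟨k, fun n hn => (border_le _).trans (hk n hn)⟩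

/-! ## Straight-line programs -/

section Programs

variable {σ : Type}

/-- The list of intermediate results, the latest one first, of a straight-line program. -/
inductive IsProgram : List (MvPolynomial σ ℂ) → Prop
  | nil : IsProgram []
  | var (i : σ) {l : List (MvPolynomial σ ℂ)} : IsProgram l → IsProgram (MvPolynomial.X i :: l)
  | const (a : ℂ) {l : List (MvPolynomial σ ℂ)} : IsProgram l → IsProgram (MvPolynomial.C a :: l)
  | add {p q : MvPolynomial σ ℂ} {l : List (MvPolynomial σ ℂ)} :
      p ∈ l → q ∈ l → IsProgram l → IsProgram ((p + q) :: l)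
  | mul {p q : MvPolynomial σ ℂ} {l : List (MvPolynomial σ ℂ)} :
      p ∈ l → q ∈ l → IsProgram l → IsProgram ((p * q) :: l)

theorem Circuit.value_eq_of_gate_eq (Γ Δ : Circuit σ) (hsize : Γ.size ≤ Δ.size)
    (hgate : ∀ (i : ℕ) (h : i < Γ.size), Δ.gate ⟨i, h.trans_le hsize⟩ = Γ.gate ⟨i, h⟩)
    (i : ℕ) (h : i < Γ.size) : Δ.value ⟨i, h.trans_le hsize⟩ = Γ.value ⟨i, h⟩ := by
  induction i using Nat.strong_induction_on with
  | _ i ih =>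
    rw [Circuit.value.eq_1 Δ, Circuit.value.eq_1 Γ, hgate i h]
    cases Γ.gate ⟨i, h⟩ with
    | var x => rfl
    | const a => rfl
    | add j k => simp only [ih j j.2 (j.2.trans h), ih k k.2 (k.2.trans h)]
    | mul j k => simp only [ih j j.2 (j.2.trans h), ih k k.2 (k.2.trans h)]

/-- A circuit with an additional gate, which becomes the output. -/
def Circuit.extend (Γ : Circuit σ) (γ : Gate σ Γ.size) : Circuit σ where
  size := Γ.size + 1
  gate i := if h : (i : ℕ) < Γ.size then Γ.gate ⟨i, h⟩ else
    -- The type of a gate depends on its position, and the new gate sits at position `Γ.size`.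
    cast (congrArg (Gate σ) (show Γ.size = (i : ℕ) by have := i.2; omega)) γ
  output := Fin.last _

theorem Circuit.extend_value_lt (Γ : Circuit σ) (γ : Gate σ Γ.size) (i : Fin Γ.size) :
    (Γ.extend γ).value ⟨i, i.2.trans (Nat.lt_succ_self _)⟩ = Γ.value i :=
  Circuit.value_eq_of_gate_eq Γ (Γ.extend γ) (Nat.le_succ _)
    (fun j hj => by simp [Circuit.extend, hj]) i i.2

theorem Circuit.extend_gate_last (Γ : Circuit σ) (γ : Gate σ Γ.size) :
    (Γ.extend γ).gate (Γ.extend γ).output = γ := by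
  simp [Circuit.extend]

/-- All members of `l` are computed by a circuit of size `l.length`. -/
def IsComputed (l : List (MvPolynomial σ ℂ)) : Prop :=
  ∃ Γ : Circuit σ, Γ.size = l.length ∧ ∀ p ∈ l, ∃ i, Γ.value i = p

theorem IsComputed.cons {l : List (MvPolynomial σ ℂ)} {Γ : Circuit σ} (hs : Γ.size = l.length)
    (hl : ∀ p ∈ l, ∃ i, Γ.value i = p) (γ : Gate σ Γ.size) {q : MvPolynomial σ ℂ}
    (hq : (Γ.extend γ).value (Γ.extend γ).output = q) : IsComputed (q :: l) := by
  refine ⟨Γ.extend γ, by simp [Circuit.extend, hs], fun p hp => ?_⟩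
  rcases List.mem_cons.mp hp with rfl | hp
  · exact ⟨_, hq⟩
  · obtain ⟨i, rfl⟩ := hl p hp
    exact ⟨_, Γ.extend_value_lt γ i⟩

theorem isComputed_X (x : σ) : IsComputed [(MvPolynomial.X x : MvPolynomial σ ℂ)] := by
  refine ⟨⟨1, fun _ => .var x, 0⟩, rfl, fun p hp => ⟨0, ?_⟩⟩
  rw [List.mem_singleton.mp hp, Circuit.value.eq_1]

theorem isComputed_C (a : ℂ) : IsComputed [(MvPolynomial.C a : MvPolynomial σ ℂ)] := by
  refine ⟨⟨1, fun _ => .const a, 0⟩, rfl, fun p hp => ⟨0, ?_⟩⟩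
  rw [List.mem_singleton.mp hp, Circuit.value.eq_1]

/-- A circuit must have an output, so the empty program is excluded and one-line programs form the
base case. -/
theorem IsProgram.isComputed {l : List (MvPolynomial σ ℂ)} (hl : IsProgram l) (hne : l ≠ []) :
    IsComputed l := by
  induction hl with
  | nil => exact absurd rfl hne
  | @var x l hl ih =>
    rcases eq_or_ne l [] with rfl | h
    · exact isComputed_X x
    · obtain ⟨Γ, hs, hΓ⟩ := ih h
      refine IsComputed.cons hs hΓ (.var x) ?_
      rw [Circuit.value.eq_1, Γ.extend_gate_last]
  | @const a l hl ih =>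
    rcases eq_or_ne l [] with rfl | h
    · exact isComputed_C a
    · obtain ⟨Γ, hs, hΓ⟩ := ih h
      refine IsComputed.cons hs hΓ (.const a) ?_
      rw [Circuit.value.eq_1, Γ.extend_gate_last]
  | @add p q l hp hq hl ih =>
    obtain ⟨Γ, hs, hΓ⟩ := ih (List.ne_nil_of_mem hp)
    obtain ⟨i, rfl⟩ := hΓ p hp
    obtain ⟨j, rfl⟩ := hΓ q hq
    refine IsComputed.cons hs hΓ (.add i j) ?_
    rw [Circuit.value.eq_1, Γ.extend_gate_last]
    exact congrArg₂ (· + ·) (Γ.extend_value_lt _ i) (Γ.extend_value_lt _ j)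
  | @mul p q l hp hq hl ih =>
    obtain ⟨Γ, hs, hΓ⟩ := ih (List.ne_nil_of_mem hp)
    obtain ⟨i, rfl⟩ := hΓ p hp
    obtain ⟨j, rfl⟩ := hΓ q hq
    refine IsComputed.cons hs hΓ (.mul i j) ?_
    rw [Circuit.value.eq_1, Γ.extend_gate_last]
    exact congrArg₂ (· * ·) (Γ.extend_value_lt _ i) (Γ.extend_value_lt _ j)

theorem circuitSize_le_of_isProgram {l : List (MvPolynomial σ ℂ)} (hl : IsProgram l)
    {p : MvPolynomial σ ℂ} (hp : p ∈ l) : circuitSize p ≤ l.length := by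
  obtain ⟨Γ, hs, hΓ⟩ := hl.isComputed (List.ne_nil_of_mem hp)
  obtain ⟨i, hi⟩ := hΓ p hp
  refine least_le_iff.mpr ⟨l.length, le_rfl, ⟨Γ.size, Γ.gate, i⟩, ?_, hs⟩
  rw [← hi]
  exact (Circuit.value_eq_of_gate_eq Γ ⟨Γ.size, Γ.gate, i⟩ le_rfl (fun _ _ => rfl) i i.2)

theorem IsProgram.append_affine {l : List (MvPolynomial σ ℂ)} (hl : IsProgram l) (s : Finset σ)
    (a : σ → ℂ) (b : ℂ) :
    ∃ l', IsProgram (l' ++ l) ∧ l'.length ≤ 4 * s.card + 1 ∧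
      MvPolynomial.C b + ∑ i ∈ s, MvPolynomial.C (a i) * MvPolynomial.X i ∈ l' ++ l := by
  classical
  induction s using Finset.induction_on with
  | empty => exact ⟨[MvPolynomial.C b], .const b hl, by simp, by simp⟩
  | insert i s hi ih =>
    obtain ⟨l', hl', hlen, hmem⟩ := ih
    set q := MvPolynomial.C b + ∑ i ∈ s, MvPolynomial.C (a i) * MvPolynomial.X i with hq
    refine ⟨(MvPolynomial.C (a i) * MvPolynomial.X i + q) :: (MvPolynomial.C (a i) * MvPolynomial.X i) ::
      MvPolynomial.C (a i) :: MvPolynomial.X i :: l', ?_, ?_, ?_⟩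
    · refine .add (by simp) ?_ (.mul (by simp) (by simp) (.const _ (.var _ hl')))
      exact List.mem_cons_of_mem _ (List.mem_cons_of_mem _ (List.mem_cons_of_mem _ hmem))
    · rw [Finset.card_insert_of_notMem hi]
      simp only [List.length_cons]
      omega
    · rw [Finset.sum_insert hi, hq]
      refine List.mem_cons.mpr (Or.inl ?_)
      ring

theorem eq_affine_of_totalDegree_le_one [Fintype σ] {p : MvPolynomial σ ℂ} (hp : p.totalDegree ≤ 1) :
    p = MvPolynomial.C (p.coeff 0) +
      ∑ i, MvPolynomial.C (p.coeff (Finsupp.single i 1)) * MvPolynomial.X i := by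
  classical
  ext m
  rw [MvPolynomial.coeff_add, MvPolynomial.coeff_sum, MvPolynomial.coeff_C]
  simp only [MvPolynomial.coeff_C_mul, MvPolynomial.coeff_X]
  by_cases h0 : m = 0
  · subst h0
    rw [if_pos rfl, Finset.sum_eq_zero, add_zero]
    intro i _
    rw [if_neg, mul_zero]
    intro h
    exact one_ne_zero (Finsupp.single_eq_zero.mp h)
  rw [if_neg (Ne.symm h0), zero_add]
  by_cases h1 : ∃ i, Finsupp.single i 1 = m
  · obtain ⟨i, rfl⟩ := h1
    rw [Finset.sum_eq_single i]
    · simp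
    · intro j _ hj
      rw [if_neg, mul_zero]
      intro h
      exact hj (Finsupp.single_left_injective one_ne_zero h)
    · simp
  · rw [Finset.sum_eq_zero fun i _ => by rw [if_neg fun h => h1 ⟨i, h⟩, mul_zero]]
    refine MvPolynomial.coeff_eq_zero_of_totalDegree_lt (lt_of_le_of_lt hp ?_)
    by_contra hlt
    have hdeg : m.degree ≤ 1 := not_lt.mp hlt
    rcases Nat.le_one_iff_eq_zero_or_eq_one.mp hdeg with h | h
    · exact h0 ((Finsupp.degree_eq_zero_iff m).mp h)
    · exact h1 (by
        obtain ⟨i, hi⟩ := Finsupp.ne_iff.mp h0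
        have hle : Finsupp.single i 1 ≤ m := by
          rw [Finsupp.single_le_iff]
          exact Nat.one_le_iff_ne_zero.mpr hi
        have hd := congrArg Finsupp.degree (add_tsub_cancel_of_le hle)
        rw [map_add, h, Finsupp.degree_single] at hd
        have h2 : m - Finsupp.single i 1 = 0 := (Finsupp.degree_eq_zero_iff _).mp (by omega)
        exact ⟨i, le_antisymm hle (tsub_eq_zero_iff_le.mp h2)⟩)

theorem IsProgram.append_of_totalDegree_le_one [Fintype σ] {l : List (MvPolynomial σ ℂ)}
    (hl : IsProgram l) {p : MvPolynomial σ ℂ} (hp : p.totalDegree ≤ 1) :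
    ∃ l', IsProgram (l' ++ l) ∧ l'.length ≤ 4 * Fintype.card σ + 1 ∧ p ∈ l' ++ l := by
  have h := hl.append_affine Finset.univ (fun i => p.coeff (Finsupp.single i 1)) (p.coeff 0)
  rwa [← eq_affine_of_totalDegree_le_one hp] at h

theorem exists_isProgram_affine [Fintype σ] (y : ℕ → MvPolynomial σ ℂ)
    (hy : ∀ i, (y i).totalDegree ≤ 1) (N : ℕ) :
    ∃ l, IsProgram l ∧ l.length ≤ N * (4 * Fintype.card σ + 1) ∧ ∀ i < N, y i ∈ l := by
  induction N with
  | zero => exact ⟨[], .nil, by simp, by simp⟩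
  | succ N ih =>
    obtain ⟨l, hl, hlen, hmem⟩ := ih
    obtain ⟨l', hl', hlen', hmem'⟩ := hl.append_of_totalDegree_le_one (hy N)
    refine ⟨l' ++ l, hl', ?_, fun i hi => ?_⟩
    · rw [List.length_append, Nat.succ_mul]
      omega
    · rcases Nat.lt_succ_iff_lt_or_eq.mp hi with h | rfl
      · exact List.mem_append_right _ (hmem i h)
      · exact hmem'

/-- Row N + 1 of the recursion arises from row N with at most one product and one addition for each
positive degree. -/
theorem IsProgram.append_alt_succ {l : List (MvPolynomial σ ℂ)} (hl : IsProgram l)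
    {y : ℕ → MvPolynomial σ ℂ} {N D : ℕ} (hy : y N ∈ l) (h : ∀ d ≤ D, alt y N d ∈ l) :
    ∃ l', IsProgram (l' ++ l) ∧ l'.length ≤ 2 * D ∧ ∀ d ≤ D, alt y (N + 1) d ∈ l' ++ l := by
  induction D with
  | zero =>
    refine ⟨[], hl, by simp, fun d hd => ?_⟩
    obtain rfl := Nat.le_zero.mp hd
    have := h 0 le_rfl
    cases N <;> exact this
  | succ D ih =>
    obtain ⟨l', hl', hlen, hmem⟩ := ih fun d hd => h d (by omega)
    have h1 : alt y N (D + 1) ∈ l' ++ l := List.mem_append_right _ (h _ le_rfl)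
    by_cases hpar : N % 2 = D % 2
    · refine ⟨(alt y N (D + 1) + y N * alt y N D) :: (y N * alt y N D) :: l', ?_, ?_, ?_⟩
      · exact .add (List.mem_cons_of_mem _ h1) List.mem_cons_self
          (.mul (List.mem_append_right _ hy) (List.mem_append_right _ (h D (by omega))) hl')
      · simp only [List.length_cons]
        omega
      · intro d hd
        rcases Nat.le_succ_iff.mp hd with hd | rfl
        · exact List.mem_cons_of_mem _ (List.mem_cons_of_mem _ (hmem d hd))
        · rw [Nat.succ_eq_add_one, alt, if_pos hpar]
          exact List.mem_cons_self
    · refine ⟨l', hl', by omega, fun d hd => ?_⟩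
      rcases Nat.le_succ_iff.mp hd with hd | rfl
      · exact hmem d hd
      · rw [Nat.succ_eq_add_one, alt, if_neg hpar, add_zero]
        exact h1

/-- Dynamic programming: the N affine forms, the constants 1 and 0 that make up row 0, and then N
rows. -/
theorem circuitSize_alt_le [Fintype σ] {y : ℕ → MvPolynomial σ ℂ}
    (hy : ∀ i, (y i).totalDegree ≤ 1) (N D : ℕ) :
    circuitSize (alt y N D) ≤ ((N * (4 * Fintype.card σ + 1) + 2 + N * (2 * D) : ℕ) : ℕ∞) := by
  obtain ⟨l, hl, hlen, hmem⟩ := exists_isProgram_affine y hy N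
  have key : ∀ M ≤ N, ∃ l', IsProgram (l' ++ l) ∧ l'.length ≤ 2 + M * (2 * D) ∧
      ∀ d ≤ D, alt y M d ∈ l' ++ l := by
    intro M hM
    induction M with
    | zero =>
      refine ⟨[MvPolynomial.C 1, MvPolynomial.C 0], .const 1 (.const 0 hl), by simp, fun d _ => ?_⟩
      cases d <;> simp [alt]
    | succ M ih =>
      obtain ⟨l', hl', hlen', hmem'⟩ := ih (by omega)
      obtain ⟨l'', hl'', hlen'', hmem''⟩ :=
        hl'.append_alt_succ (List.mem_append_right _ (hmem M (by omega))) hmem'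
      refine ⟨l'' ++ l', by rwa [List.append_assoc], ?_, by rwa [List.append_assoc]⟩
      rw [List.length_append, Nat.succ_mul]
      omega
  obtain ⟨l', hl', hlen', hmem'⟩ := key N le_rfl
  refine (circuitSize_le_of_isProgram hl' (hmem' D le_rfl)).trans ?_
  rw [List.length_append]
  exact_mod_cast (by omega)

theorem circuitSize_le_of_totalDegree_le_one [Fintype σ] {p : MvPolynomial σ ℂ}
    (hp : p.totalDegree ≤ 1) : circuitSize p ≤ ((4 * Fintype.card σ + 1 : ℕ) : ℕ∞) := by
  obtain ⟨l, hl, hlen, hmem⟩ := IsProgram.nil.append_of_totalDegree_le_one hp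
  refine (circuitSize_le_of_isProgram hl hmem).trans ?_
  rw [List.append_nil]
  exact_mod_cast hlen

end Programs

/-! ## Orbit closures -/

section Substitution

variable {σ τ : Type} [Fintype τ]

theorem isHomogeneous_of_mem_limits {S : Set (MvPolynomial σ ℂ)} {d : ℕ}
    (hS : ∀ h ∈ S, h.IsHomogeneous d) {f : MvPolynomial σ ℂ} (hf : f ∈ limits S) :
    f.IsHomogeneous d := by
  obtain ⟨h, hh, hlim⟩ := hf
  intro m hm
  by_contra hne
  refine hm (tendsto_nhds_unique (hlim m) ?_)
  have : (fun k => (h k).coeff m) = fun _ => 0 := by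
    funext k
    by_contra hk
    exact hne (hS _ (hh k) hk)
  rw [this]
  exact tendsto_const_nhds

/-- Substitution is compatible with limits of homogeneous polynomials of a fixed degree. -/
theorem aeval_mem_limits {S : Set (MvPolynomial τ ℂ)} {d : ℕ}
    (hS : ∀ h ∈ S, h.IsHomogeneous d) {f : MvPolynomial τ ℂ} (hf : f ∈ limits S)
    (g : τ → MvPolynomial σ ℂ) :
    MvPolynomial.aeval g f ∈ limits ((fun p => MvPolynomial.aeval g p) '' S) := by
  classical
  have hfd := isHomogeneous_of_mem_limits hS hf
  obtain ⟨h, hh, hlim⟩ := hf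
  refine ⟨fun k => MvPolynomial.aeval g (h k), fun k => ⟨h k, hh k, rfl⟩, fun m => ?_⟩
  -- Homogeneity confines the exponents to a finite set independent of p. With unbounded degrees,
  -- coefficientwise convergence would not survive a substitution of polynomials with constant
  -- terms.
  have key : ∀ p : MvPolynomial τ ℂ, p.IsHomogeneous d → (MvPolynomial.aeval g p).coeff m =
      ∑ u ∈ Finset.univ.finsuppAntidiag d, p.coeff u * (∏ i, g i ^ u i).coeff m := by
    intro p hp
    rw [MvPolynomial.aeval_def, MvPolynomial.eval₂_eq', MvPolynomial.coeff_sum]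
    simp only [MvPolynomial.algebraMap_eq, MvPolynomial.coeff_C_mul]
    refine Finset.sum_subset (fun u hu => ?_) fun u _ hu => ?_
    · rw [Finset.mem_finsuppAntidiag]
      refine ⟨?_, Finset.subset_univ _⟩
      have := hp (MvPolynomial.mem_support_iff.mp hu)
      rw [← this, Finsupp.weight_apply, Finsupp.sum_fintype]
      · simp
      · simp
    · rw [MvPolynomial.notMem_support_iff.mp hu, zero_mul]
  rw [key f hfd]
  simp only [fun k => key (h k) (hS _ (hh k))]
  exact tendsto_finsetSum _ fun u _ => (hlim u).mul_const _

end Substitution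

/-! ### From degenerations to orbit closures by density of the invertible matrices -/

section Orbits

theorem isHomogeneous_compLinear {σ τ : Type} [Fintype σ] {p : MvPolynomial τ ℂ} {d : ℕ}
    (hp : p.IsHomogeneous d) (A : Matrix τ σ ℂ) : (compLinear p A).IsHomogeneous d := by
  have := hp.aeval (fun j => ∑ i, MvPolynomial.C (A j i) * MvPolynomial.X i) (n := 1) (fun j =>
    MvPolynomial.IsHomogeneous.sum _ _ _ fun i _ => by
      simpa using (MvPolynomial.isHomogeneous_C σ (A j i)).mul (MvPolynomial.isHomogeneous_X ℂ i))
  rwa [one_mul] at this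

theorem continuous_alt {X A : Type*} [TopologicalSpace X] [CommRing A] [TopologicalSpace A]
    [IsTopologicalSemiring A] {y : X → ℕ → A} (hy : ∀ i, Continuous fun x => y x i) (N d : ℕ) :
    Continuous fun x => alt (y x) N d := by
  induction N generalizing d with
  | zero => cases d <;> exact continuous_const
  | succ N ih =>
    cases d with
    | zero => exact continuous_const
    | succ d =>
      simp only [alt]
      refine (ih (d + 1)).add ?_
      split_ifs
      · exact (hy N).mul (ih d)
      · exact continuous_const

/-- The determinant vanishes only at the finitely many eigenvalues of -A. -/
theorem dense_det_add_ne_zero {r : ℕ} (A : Matrix (Fin r) (Fin r) ℂ) :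
    Dense {t : ℂ | (A + Matrix.scalar (Fin r) t).det ≠ 0} := by
  have hfin : {t : ℂ | (A + Matrix.scalar (Fin r) t).det = 0}.Finite := by
    refine ((-A).charpoly.roots.toFinset.finite_toSet).subset fun t ht => ?_
    rw [Finset.mem_coe, Multiset.mem_toFinset, Polynomial.mem_roots (-A).charpoly_monic.ne_zero,
      Polynomial.IsRoot, Matrix.eval_charpoly, sub_neg_eq_add, add_comm]
    exact ht
  exact hfin.countable.dense_compl ℂ

/-- A is the limit of the matrices A + t as t → 0 through values where they are invertible. -/
theorem compLinear_mem_orbitClosure {r d : ℕ} (A : Matrix (Fin r) (Fin r) ℂ) :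
    compLinear (parityAltPoly r d) A ∈ orbitClosure (parityAltPoly r d) := by
  let y : ℂ → ℕ → Fin r → ℂ := fun t i j =>
    if h : i < r then (A + Matrix.scalar (Fin r) t) ⟨i, h⟩ j else 0
  have hcoe : ∀ t, ((compLinear (parityAltPoly r d) (A + Matrix.scalar (Fin r) t) :
      MvPolynomial (Fin r) ℂ) : Ser (Fin r)) = alt (fun i => linForm (y t i)) r d := by
    intro t
    rw [← coe_compLinear_parityAltPoly]
    congr 2
    ext i j
    simp [y]
  have hcont : Continuous fun t => alt (fun i => linForm (y t i)) r d := by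
    refine continuous_alt (fun i => ?_) r d
    refine continuous_finsetSum _ fun j _ => Continuous.mul ?_ continuous_const
    refine MvPowerSeries.WithPiTopology.continuous_C.comp ?_
    simp only [y]
    split_ifs with h
    · simp only [Matrix.add_apply, Matrix.scalar_apply, Matrix.diagonal_apply]
      split_ifs <;> fun_prop
    · exact continuous_const
  rw [orbitClosure, mem_limits_iff]
  have h0 := hcoe 0
  rw [map_zero, add_zero] at h0
  rw [h0]
  refine map_mem_closure (f := fun t => alt (fun i => linForm (y t i)) r d) hcont
    (dense_det_add_ne_zero A 0) fun t ht => ?_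
  show alt (fun i => linForm (y t i)) r d ∈ _
  rw [← hcoe]
  refine ⟨_, ⟨Matrix.GeneralLinearGroup.mkOfDetNeZero (A + Matrix.scalar (Fin r) t).transpose
    (by rwa [Matrix.det_transpose]), ?_⟩, rfl⟩
  simp [Matrix.GeneralLinearGroup.mkOfDetNeZero]

theorem rename_compLinear {v r N : ℕ} (h : v ≤ r) (p : MvPolynomial (Fin N) ℂ)
    (A : Matrix (Fin N) (Fin v) ℂ) :
    ∃ B : Matrix (Fin N) (Fin r) ℂ,
      MvPolynomial.rename (Fin.castLE h) (compLinear p A) = compLinear p B := by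
  refine ⟨fun j i => ∑ k, if Fin.castLE h k = i then A j k else 0, ?_⟩
  unfold compLinear
  rw [← AlgHom.comp_apply, MvPolynomial.comp_aeval]
  congr 2
  funext j
  simp only [map_sum, map_mul, MvPolynomial.rename_C, MvPolynomial.rename_X, Finset.sum_mul]
  rw [Finset.sum_comm]
  refine Finset.sum_congr rfl fun k _ => ?_
  rw [Finset.sum_eq_single (Fin.castLE h k)]
  · simp
  · intro i _ hi
    rw [if_neg (Ne.symm hi)]
    simp
  · simp

/-- Zero forms enlarge `C_{N,d}` to `C_{r,d}` and dummy variables make the matrices square; then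
each projection is already in the orbit closure. -/
theorem rename_mem_orbitClosure {v N r d : ℕ} (hv : v ≤ r) (hN : N ≤ r)
    {f : MvPolynomial (Fin v) ℂ} (hf : IsDegeneration f (parityAltPoly N d)) :
    MvPolynomial.rename (Fin.castLE hv) f ∈ orbitClosure (parityAltPoly r d) := by
  have hf' : IsDegeneration f (parityAltPoly r d) :=
    isDegeneration_iff.mpr (closure_mono (projections_mono hN d) (isDegeneration_iff.mp hf))
  have h := aeval_mem_limits (d := d) (by
    rintro _ ⟨A, rfl⟩
    exact isHomogeneous_compLinear (parityAltPoly_isHomogeneous r d) A) hf'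
    (fun i => (MvPolynomial.X (Fin.castLE hv i) : MvPolynomial (Fin r) ℂ))
  have e : ∀ p : MvPolynomial (Fin v) ℂ,
      MvPolynomial.aeval (fun i => (MvPolynomial.X (Fin.castLE hv i) : MvPolynomial (Fin r) ℂ)) p =
        MvPolynomial.rename (Fin.castLE hv) p :=
    DFunLike.congr_fun (MvPolynomial.algHom_ext fun i => by simp)
  simp only [e] at h
  refine limits_limits_subset _ (limits_mono ?_ h)
  rintro _ ⟨_, ⟨A, rfl⟩, rfl⟩
  obtain ⟨B, hB⟩ := rename_compLinear hv (parityAltPoly r d) A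
  simp only [hB]
  exact compLinear_mem_orbitClosure B

end Orbits

/-! ## The permanent -/

section Permanent

theorem isHomogeneous_per (m : ℕ) : (per m).IsHomogeneous m := by
  unfold per Matrix.permanent
  refine MvPolynomial.IsHomogeneous.sum _ _ _ fun s _ => ?_
  simpa using MvPolynomial.IsHomogeneous.prod Finset.univ
    (fun i : Fin m => (MvPolynomial.X (finProdFinEquiv (s i, i)) : MvPolynomial (Fin (m * m)) ℂ))
    (fun _ => 1) (fun i _ => MvPolynomial.isHomogeneous_X ℂ _)

theorem aeval_per {A : Type*} [CommRing A] [Algebra ℂ A] {m : ℕ} (M : Matrix (Fin m) (Fin m) A)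
    {y : Fin (m * m) → A} (hy : ∀ i j, y (finProdFinEquiv (i, j)) = M i j) :
    MvPolynomial.aeval y (per m) = M.permanent := by
  simp [per, Matrix.permanent, map_sum, map_prod, hy]

theorem per_ne_zero (m : ℕ) : per m ≠ 0 := by
  intro h
  have := aeval_per (1 : Matrix (Fin m) (Fin m) ℂ)
    (y := fun k => if (finProdFinEquiv.symm k).1 = (finProdFinEquiv.symm k).2 then 1 else 0)
    (fun i j => by rw [Equiv.symm_apply_apply, Matrix.one_apply])
  rw [h, map_zero, Matrix.permanent_one] at this
  exact zero_ne_one this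

theorem totalDegree_per (m : ℕ) : (per m).totalDegree = m :=
  (isHomogeneous_per m).totalDegree (per_ne_zero m)

/-- The p-family of the permanents. -/
noncomputable def perFamily : PFamily where
  nvars m := m * m
  poly := per
  nvars_bounded := ⟨Polynomial.X * Polynomial.X, fun n => by simp⟩
  degree_bounded := ⟨Polynomial.X, fun n => by simp [totalDegree_per]⟩

theorem perFamily_mem_vnp : perFamily ∈ VNP := by
  refine ⟨Polynomial.X, fun n => ?_⟩
  rw [Polynomial.eval_X]
  refine least_le_iff.mpr
    ⟨n, le_rfl, Matrix.of fun i j => MvPolynomial.X (finProdFinEquiv (i, j)), ?_, rfl⟩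
  intro i j
  exact (MvPolynomial.totalDegree_X _).le

theorem quasiPolyBounded_orbitClosureComplexity_per (h : VNP ⊆ VQPClosure) :
    QuasiPolyBounded fun m => orbitClosureComplexity (per m) := by
  obtain ⟨q, hq, hdeg⟩ := borderQPHard_vqpClosure _ (h perFamily_mem_vnp)
  obtain ⟨k, hk⟩ := quasiPolyBounded_iff.mp hq
  refine quasiPolyBounded_of_le_two_pow ((Polynomial.X + 2) ^ k + (Polynomial.X + 2) * 2)
    fun n hn => ?_
  rw [orbitClosureComplexity, least_le_iff]
  -- The number of variables must be at least both q(n) and n².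
  refine ⟨q n + n * n, ?_, by omega, ?_⟩
  · have h1 : q n ≤ 2 ^ (Nat.log 2 n + 2) ^ k := by exact_mod_cast hk n hn
    have h2 : n * n + 1 ≤ 2 ^ ((Nat.log 2 n + 2) * 2) := by
      refine le_trans ?_ (add_two_pow_le n 2)
      nlinarith
    have h3 : 1 ≤ 2 ^ (Nat.log 2 n + 2) ^ k := Nat.one_le_two_pow
    simp only [Polynomial.eval_add, Polynomial.eval_pow, Polynomial.eval_mul, Polynomial.eval_X,
      Polynomial.eval_ofNat, pow_add]
    nlinarith [Nat.mul_le_mul h3 h2]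
  · rw [totalDegree_per]
    have : IsDegeneration (MvPolynomial.homogeneousComponent n (per n))
      (parityAltPoly (q n) n) := hdeg n n (by omega)
    rw [MvPolynomial.homogeneousComponent_of_mem (isHomogeneous_per n), if_pos rfl] at this
    exact rename_mem_orbitClosure _ (by omega) this

/-- Substituting the entries of M into an approximation of `per s` by orbit points of `C` yields
approximations of the permanent of M by `C` at affine forms, which have small circuits. -/
theorem border_circuitSize_permanent_le {σ : Type} [Fintype σ] {s r : ℕ}
    (hr : orbitClosureComplexity (per s) ≤ r) (M : Matrix (Fin s) (Fin s) (MvPolynomial σ ℂ))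
    (hM : ∀ i j, (M i j).totalDegree ≤ 1) :
    border circuitSize M.permanent ≤
      ((r * (4 * Fintype.card σ + 1) + 2 + r * (2 * r) : ℕ) : ℕ∞) := by
  obtain ⟨t, htr, hv, hmem⟩ := least_le_iff.mp hr
  rw [totalDegree_per] at hmem
  -- The dummy variables beyond the s² entries are replaced by 0.
  let g : Fin t → MvPolynomial σ ℂ := fun k =>
    if h : (k : ℕ) < s * s then M (finProdFinEquiv.symm ⟨k, h⟩).1 (finProdFinEquiv.symm ⟨k, h⟩).2
    else 0
  have hg : ∀ k, (g k).totalDegree ≤ 1 := by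
    intro k
    simp only [g]
    split_ifs
    · exact hM _ _
    · simp
  have h := aeval_mem_limits (d := s) (by
    rintro _ ⟨A, rfl⟩
    exact isHomogeneous_compLinear (parityAltPoly_isHomogeneous t s) _) hmem g
  have e : MvPolynomial.aeval g (MvPolynomial.rename (Fin.castLE hv) (per s)) = M.permanent := by
    rw [MvPolynomial.aeval_rename]
    refine aeval_per M fun i j => ?_
    simp only [g, Function.comp, Fin.val_castLE, Fin.is_lt, dite_true, Fin.eta,
      Equiv.symm_apply_apply]
  rw [e] at h
  rw [border, least_le_iff]
  refine ⟨_, le_rfl, limits_mono ?_ h⟩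
  rintro _ ⟨_, ⟨A, rfl⟩, rfl⟩
  let y : ℕ → MvPolynomial σ ℂ := fun j => if hj : j < t then
    ∑ i, MvPolynomial.C ((A : Matrix (Fin t) (Fin t) ℂ).transpose ⟨j, hj⟩ i) * g i else 0
  have hy : ∀ j, (y j).totalDegree ≤ 1 := by
    intro j
    simp only [y]
    split_ifs
    · refine MvPolynomial.totalDegree_finsetSum_le fun i _ => ?_
      refine (MvPolynomial.totalDegree_mul _ _).trans ?_
      rw [MvPolynomial.totalDegree_C, zero_add]
      exact hg i
    · simp
  have e2 : MvPolynomial.aeval g (compLinear (parityAltPoly t s)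
      (A : Matrix (Fin t) (Fin t) ℂ).transpose) = alt y t s := by
    rw [← aeval_parityAltPoly]
    unfold compLinear
    rw [← AlgHom.comp_apply, MvPolynomial.comp_aeval]
    congr 2
    funext j
    simp [y]
  show circuitSize _ ≤ _
  simp only [e2]
  refine (circuitSize_alt_le hy t s).trans ?_
  -- The degree is bounded by r because s ≤ s² ≤ t ≤ r.
  have hst : s ≤ r := by
    rcases Nat.eq_zero_or_pos s with rfl | hs
    · omega
    · exact ((Nat.le_mul_of_pos_left s hs).trans hv).trans htr
  have h1 : t * (4 * Fintype.card σ + 1) ≤ r * (4 * Fintype.card σ + 1) :=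
    Nat.mul_le_mul_right _ htr
  have h2 : t * (2 * s) ≤ r * (2 * r) := Nat.mul_le_mul htr (by omega)
  exact_mod_cast (by omega)

theorem totalDegree_permanent_le_one {σ : Type} {s : ℕ} (hs : s < 2)
    (M : Matrix (Fin s) (Fin s) (MvPolynomial σ ℂ)) (hM : ∀ i j, (M i j).totalDegree ≤ 1) :
    M.permanent.totalDegree ≤ 1 := by
  interval_cases s
  · rw [Matrix.permanent_isEmpty]
    simp
  · rw [Matrix.permanent_unique]
    exact hM _ _

theorem vnp_subset_vqpClosure (h : QuasiPolyBounded fun m => orbitClosureComplexity (per m)) :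
    VNP ⊆ VQPClosure := by
  intro f hf
  obtain ⟨k, hk⟩ := quasiPolyBounded_iff.mp h
  obtain ⟨a, ha⟩ := polyBounded_iff.mp hf
  obtain ⟨b, hb⟩ := polyBounded_iff.mp f.nvars_bounded
  let A : Polynomial ℕ := ((Polynomial.X + 2) * (a : Polynomial ℕ) + 2) ^ k
  let B : Polynomial ℕ := (Polynomial.X + 2) * (b : Polynomial ℕ)
  refine quasiPolyBounded_of_le_two_pow (2 * A + B + 4) fun n hn => ?_
  obtain ⟨s, hs, M, hM, hperm⟩ := least_le_iff.mp (ha n)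
  have hvars : Fintype.card (Fin (f.nvars n)) ≤ 2 ^ B.eval (Nat.log 2 n) := by
    have h1 : f.nvars n ≤ (n + 2) ^ b := by exact_mod_cast hb n
    simpa [B] using h1.trans (add_two_pow_le n b)
  set v := Fintype.card (Fin (f.nvars n))
  set α := A.eval (Nat.log 2 n) with hα
  set β := B.eval (Nat.log 2 n)
  have hsum : 2 ^ α * (4 * v + 1) + 2 + 2 ^ α * (2 * 2 ^ α) ≤ 2 ^ (2 * α + β + 4) := by
    have h1 : 1 ≤ 2 ^ α := Nat.one_le_two_pow
    have h2 : 1 ≤ 2 ^ β := Nat.one_le_two_pow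
    have e : 2 ^ (2 * α + β + 4) = 2 ^ α * 2 ^ α * 2 ^ β * 16 := by ring
    rw [e]
    set x := 2 ^ α
    set z := 2 ^ β
    have h3 : x * v ≤ x * z := Nat.mul_le_mul_left x hvars
    have h4 : x * z ≤ x * x * z := by
      rw [mul_assoc]
      exact Nat.le_mul_of_pos_left _ h1
    have h5 : x * x ≤ x * x * z := Nat.le_mul_of_pos_right _ h2
    have h6 : x ≤ x * x := Nat.le_mul_of_pos_left _ h1
    nlinarith
  have heval : (2 * A + B + 4).eval (Nat.log 2 n) = 2 * α + β + 4 := by simp [α, β]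
  rw [heval, ← hperm]
  -- The hypothesis bounds the complexity of `per s` only for s ≥ 2. Permanents of smaller size are
  -- affine and are bounded directly.
  by_cases hs2 : 2 ≤ s
  · have hlog : Nat.log 2 s ≤ (Nat.log 2 n + 2) * a := by
      calc Nat.log 2 s ≤ Nat.log 2 (2 ^ ((Nat.log 2 n + 2) * a)) :=
            Nat.log_mono_right (hs.trans (add_two_pow_le n a))
        _ = _ := Nat.log_pow (by norm_num) _
    have hr : orbitClosureComplexity (per s) ≤ ((2 ^ α : ℕ) : ℕ∞) := by
      refine (hk s hs2).trans ?_
      have : (Nat.log 2 s + 2) ^ k ≤ α := by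
        have h1 : α = ((Nat.log 2 n + 2) * a + 2) ^ k := by simp [hα, A]
        rw [h1]
        exact Nat.pow_le_pow_left (by omega) k
      exact_mod_cast Nat.pow_le_pow_right (by norm_num) this
    refine (border_circuitSize_permanent_le hr M hM).trans ?_
    exact_mod_cast hsum
  · refine (border_le _).trans ((circuitSize_le_of_totalDegree_le_one
      (totalDegree_permanent_le_one (by omega) M hM)).trans ?_)
    have h1 : 1 * (4 * v + 1) ≤ 2 ^ α * (4 * v + 1) :=
      Nat.mul_le_mul_right _ Nat.one_le_two_pow
    exact_mod_cast (by omega : 4 * v + 1 ≤ 2 ^ (2 * α + β + 4))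

end Permanent

end AlgComplexity

theorem mainTheorem6 :
    AlgComplexity.BorderPHard AlgComplexity.parityAlt AlgComplexity.V3F ∧
    AlgComplexity.BorderPHard AlgComplexity.parityAlt AlgComplexity.V3FClosure ∧
    AlgComplexity.BorderQPHard AlgComplexity.parityAlt
      (AlgComplexity.VQP ∩ AlgComplexity.Homogeneous) ∧
    AlgComplexity.BorderQPHard AlgComplexity.parityAlt
      (AlgComplexity.VQPClosure ∩ AlgComplexity.Homogeneous) ∧
    (AlgComplexity.ExtendedMulmuleySohoni ↔
      ¬ AlgComplexity.QuasiPolyBounded fun m : ℕ =>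
        AlgComplexity.orbitClosureComplexity (AlgComplexity.per m)) := by
  refine ⟨fun g hg => ?_, ?_, fun g hg => ?_, fun g hg => ?_, ?_⟩
  · exact AlgComplexity.borderPHard_v3FClosure g (AlgComplexity.v3F_subset_v3FClosure hg)
  · exact AlgComplexity.borderPHard_v3FClosure
  · exact AlgComplexity.borderQPHard_vqpClosure g (AlgComplexity.vqp_subset_vqpClosure hg.1)
  · exact AlgComplexity.borderQPHard_vqpClosure g hg.1
  · exact not_congr ⟨AlgComplexity.quasiPolyBounded_orbitClosureComplexity_per,
      AlgComplexity.vnp_subset_vqpClosure⟩
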